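/- **Setting.** Let $G=(V,E)$ be a finite graph with vertex connectivity $k$, let $L\ge 0$ and $t\ge 1$ be integers, and read $L/2$ as $\lfloor L/2\rfloor$. The virtual graph $\mathcal G$ has, for every $v\in V$, one virtual node for each layer number in $\{1,\dots,L\}$ and each type number in $\{1,2,3\}$; two distinct virtual nodes are adjacent if they belong to the same vertex of $G$ or to two adjacent vertices of $G$. The virtual nodes are assigned to classes $1,\dots,t$ layer by layer. Let $\mathcal V^i_\ell$ be the set of virtual nodes of layers $1,\dots,\ell$ in class $i$, let $N^i_\ell$ be the number of connected components of $\mathcal G[\mathcal V^i_\ell]$, and let $M_\ell=\sum_{i=1}^t (N^i_\ell-1)$. Each virtual node of layers $1,\dots,L/2$ joins an independent, uniformly random class. For $\ell=L/2,\dots,L-1$, the nodes of layer $\ell+1$ (the new nodes) are then assigned as follows. 1. Each new node of type 1 or 3 joins an independent, uniformly random class. 2. The bridging graph is the bipartite graph between the components of the graphs $\mathcal G[\mathcal V^i_\ell]$, $1\le i\le t$, and the type-2 new nodes, in which a type-2 new node $v$ is adjacent to a component $\mathcal C$ of $\mathcal G[\mathcal V^i_\ell]$ if (a) $v$ has a neighbor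 in $\mathcal C$; (b) no type-1 new node that joined class $i$ has both a neighbor in $\mathcal C$ and a neighbor in another component of $\mathcal G[\mathcal V^i_\ell]$; and (c) $v$ has a type-3 new neighbor that joined class $i$ and has a neighbor in a component of $\mathcal G[\mathcal V^i_\ell]$ other than $\mathcal C$. 3. A maximal (with respect to inclusion) matching of the bridging graph is found by an arbitrary, possibly randomized, rule. Each matched type-2 new node joins the class of its matched component; each unmatched one joins an independent, uniformly random class. Let $D$ be the event that for every class $i$, $\mathcal V^i_{L/2}$ is a dominating set of $\mathcal G$. **Lemma (Fast Merger Lemma).** For every constant $c>0$ there are constants $\delta>0$ and $\rho\in(0,1]$, depending only on $c$, such that the following holds for all $G$, $L$, $t$ as above with $1\le t\le c\,k$, and for every matching rule. * On the event $D$, $M_{\ell+1}\le M_\ell$ for every $\ell\in[L/2,L-1]$. * For every $\ell\in[L/2,L-1]$ and every assignment $b$ of the layers $1,\dots,\ell$ that occurs with positive probability and for which $D$ holds, $$\Pr\big[M_{\ell+1}\le(1-\delta)M_\ell \,\big|\, \text{layers } 1,\dots,\ell \text{ are assigned by } b\big]\ge\rho .$$ * Moreover, the layers succeed at least as often as independent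 trials: for every upward closed family $\mathcal U$ of sets of integers, the set of those $\ell\in[L/2,L-1]$ with $M_{\ell+1}\le(1-\delta)M_\ell$ satisfies $$\Pr\big[D \text{ and } \{\ell : M_{\ell+1}\le(1-\delta)M_\ell\}\in\mathcal U\big]\ \ge\ \Pr[D]\cdot\Pr[R\in\mathcal U],$$ where $R\subseteq[L/2,L-1]$ is a random set that contains each integer of $[L/2,L-1]$ independently with probability $\rho$. -/

import Mathlib

namespace FastMerger

open scoped Classical in
/-- The vertex connectivity of a finite graph: the largest `k` such that `G` has more than `k`
vertices and stays connected after the deletion of any fewer than `k` vertices. In particular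
the complete graph on `n` vertices has vertex connectivity `n - 1`. -/
noncomputable def vertexConnectivity {V : Type*} [Fintype V] (G : SimpleGraph V) : ℕ :=
  sSup {k : ℕ | k < Fintype.card V ∧
    ∀ S : Finset V, S.card < k → (G.induce {v | v ∉ S}).Connected}

/-- Virtual nodes: every real node has exactly one virtual node for each layer number in
`{1, …, L}` and each type number in `{1, 2, 3}`. -/
abbrev VNode (V : Type*) (L : ℕ) := V × Fin L × Fin 3

section Nodes
variable {V : Type*} {L : ℕ}

/-- The real node that simulates a virtual node. -/
def realNode (x : VNode V L) : V := x.1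

/-- The layer number, in `{1, …, L}`. -/
def layerNo (x : VNode V L) : ℕ := x.2.1.val + 1

/-- The type number, in `{1, 2, 3}`. -/
def typeNo (x : VNode V L) : ℕ := x.2.2.val + 1

/-- The virtual graph: two different virtual nodes are adjacent if they are simulated by the
same real node or by two adjacent real nodes. -/
def virtualGraph (G : SimpleGraph V) (L : ℕ) : SimpleGraph (VNode V L) where
  Adj x y := x ≠ y ∧ (realNode x = realNode y ∨ G.Adj (realNode x) (realNode y))
  symm := ⟨fun _ _ h => ⟨h.1.symm, h.2.imp Eq.symm (fun e => e.symm)⟩⟩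
  loopless := ⟨fun _ h => h.1 rfl⟩

end Nodes

/-- A (partial) assignment of the virtual nodes to the classes `0, …, t - 1`;
`none` means that the node has not joined a class yet. -/
abbrev Assignment (V : Type*) (L t : ℕ) := VNode V L → Option (Fin t)

section Components
variable {V : Type*} {L t : ℕ}

/-- The set of virtual nodes of layers `1, …, ℓ` that are assigned to class `i`. -/
def classSet (a : Assignment V L t) (ℓ : ℕ) (i : Fin t) : Set (VNode V L) :=
  {x | layerNo x ≤ ℓ ∧ a x = some i}

/-- The part of an assignment that concerns layers `1, …, ℓ`. -/
def upTo (a : Assignment V L t) (ℓ : ℕ) : Assignment V L t :=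
  fun x => if layerNo x ≤ ℓ then a x else none

/-- The connected components of the subgraph of the virtual graph that is induced by the nodes
of layers `1, …, ℓ` in class `i`. -/
abbrev Comp (G : SimpleGraph V) (a : Assignment V L t) (ℓ : ℕ) (i : Fin t) :=
  ((virtualGraph G L).induce (classSet a ℓ i)).ConnectedComponent

/-- `M_ℓ = ∑ i, (N_ℓ^i - 1)`, where `N_ℓ^i` is the number of components of class `i`. -/
noncomputable def excess (G : SimpleGraph V) (a : Assignment V L t) (ℓ : ℕ) : ℤ :=
  ∑ i : Fin t, ((Nat.card (Comp G a ℓ i) : ℤ) - 1)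

/-- `S` is a dominating set of the graph `H`. -/
def IsDominating {W : Type*} (H : SimpleGraph W) (S : Set W) : Prop :=
  ∀ x, x ∉ S → ∃ y ∈ S, H.Adj x y

/-- Every class, restricted to layers `1, …, L / 2`, dominates the virtual graph. -/
def HalfDominating (G : SimpleGraph V) (a : Assignment V L t) : Prop :=
  ∀ i : Fin t, IsDominating (virtualGraph G L) (classSet a (L / 2) i)

/-- The virtual node `x` has a neighbor in the component `C`. -/
def HasNbrIn (G : SimpleGraph V) (a : Assignment V L t) (ℓ : ℕ) {i : Fin t}
    (x : VNode V L) (C : Comp G a ℓ i) : Prop :=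
  ∃ y : classSet a ℓ i,
    ((virtualGraph G L).induce (classSet a ℓ i)).connectedComponentMk y = C ∧
      (virtualGraph G L).Adj x y

/-- `x` is a new node (that is, of layer `ℓ + 1`) of type `r`. -/
def IsNew (ℓ r : ℕ) (x : VNode V L) : Prop := layerNo x = ℓ + 1 ∧ typeNo x = r

/-- The condition under which the type-2 new node `v` and the component `C` of class `i` are
adjacent in the bridging graph. Here `a` is the assignment in which the nodes of layers
`1, …, ℓ` and the new nodes of types 1 and 3 have joined their classes. -/
def Bridges (G : SimpleGraph V) (a : Assignment V L t) (ℓ : ℕ) {i : Fin t}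
    (C : Comp G a ℓ i) (v : VNode V L) : Prop :=
  HasNbrIn G a ℓ v C ∧
  (¬ ∃ u, IsNew ℓ 1 u ∧ a u = some i ∧ HasNbrIn G a ℓ u C ∧
      ∃ C' : Comp G a ℓ i, C' ≠ C ∧ HasNbrIn G a ℓ u C') ∧
  ∃ w, IsNew ℓ 3 w ∧ a w = some i ∧ (virtualGraph G L).Adj v w ∧
      ∃ C'' : Comp G a ℓ i, C'' ≠ C ∧ HasNbrIn G a ℓ w C''

/-- The vertices of the bridging graph: the components of the old nodes of all the classes,
and the type-2 new nodes. -/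
abbrev BridgeVertex (G : SimpleGraph V) (a : Assignment V L t) (ℓ : ℕ) :=
  (Σ i : Fin t, Comp G a ℓ i) ⊕ {x : VNode V L // IsNew ℓ 2 x}

/-- The bipartite bridging graph. -/
def bridgingGraph (G : SimpleGraph V) (a : Assignment V L t) (ℓ : ℕ) :
    SimpleGraph (BridgeVertex G a ℓ) :=
  SimpleGraph.fromRel fun p q =>
    ∃ (C : Σ i : Fin t, Comp G a ℓ i) (v : {x : VNode V L // IsNew ℓ 2 x}),
      p = Sum.inl C ∧ q = Sum.inr v ∧ Bridges G a ℓ C.2 v.1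

/-- The maximal (with respect to inclusion) matchings of a graph. -/
abbrev MaximalMatching {W : Type*} (H : SimpleGraph W) :=
  {M : H.Subgraph // Maximal (fun M : H.Subgraph => M.IsMatching) M}

/-- `M` matches the virtual node `x` to the component `C`. -/
def MatchedTo {G : SimpleGraph V} {a : Assignment V L t} {ℓ : ℕ}
    (M : (bridgingGraph G a ℓ).Subgraph) (C : Σ i : Fin t, Comp G a ℓ i) (x : VNode V L) : Prop :=
  ∃ hx : IsNew ℓ 2 x, M.Adj (Sum.inl C) (Sum.inr ⟨x, hx⟩)

/-- A way of finding a maximal matching of the bridging graph: for each `ℓ` and each assignment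
of the nodes of layers `1, …, ℓ` and the type-1 and type-3 nodes of layer `ℓ + 1`, a (possibly
random) maximal matching of the corresponding bridging graph. -/
abbrev MatchingRule (G : SimpleGraph V) (L t : ℕ) :=
  (ℓ : ℕ) → (a : Assignment V L t) → PMF (MaximalMatching (bridgingGraph G a ℓ))

open scoped Classical in
/-- Every node matched by `M` joins the class of the component it is matched to. -/
noncomputable def joinMatched {G : SimpleGraph V} {a : Assignment V L t} {ℓ : ℕ}
    (M : (bridgingGraph G a ℓ).Subgraph) : Assignment V L t :=
  fun x => if h : ∃ C, MatchedTo M C x then some h.choose.1 else a x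

end Components

section RandomAssignment
variable {V : Type*} [Fintype V] {L t : ℕ} [NeZero t]

open scoped Classical in
/-- Every node of `S` joins an independent, uniformly random class. -/
noncomputable def joinRandom (S : Set (VNode V L)) (a : Assignment V L t) :
    PMF (Assignment V L t) :=
  (PMF.uniformOfFintype (VNode V L → Fin t)).map fun c x => if x ∈ S then some (c x) else a x

/-- The recursive class assignment of layer `ℓ + 1`, given the assignment of layers
`1, …, ℓ`: the new nodes of types 1 and 3 join random classes, a maximal matching of the bridging
graph is found, the matched type-2 new nodes join the classes of their components, and the
unmatched type-2 new nodes join random classes. -/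
noncomputable def recursiveStep {G : SimpleGraph V} (rule : MatchingRule G L t) (ℓ : ℕ)
    (a : Assignment V L t) : PMF (Assignment V L t) :=
  (joinRandom {x | IsNew ℓ 1 x ∨ IsNew ℓ 3 x} a).bind fun a₁ =>
    (rule ℓ a₁).bind fun M =>
      joinRandom {x | IsNew ℓ 2 x ∧ ¬ ∃ C, MatchedTo M.1 C x} (joinMatched M.1)

/-- The law of the assignment after layers `1, …, ℓ` have been assigned. Layers `1, …, L / 2` are
assigned uniformly at random, the later ones by the recursive step. -/
noncomputable def run {G : SimpleGraph V} (rule : MatchingRule G L t) :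
    ℕ → PMF (Assignment V L t)
  | 0 => PMF.pure fun _ => none
  | ℓ + 1 => (run rule ℓ).bind fun a =>
      if ℓ + 1 ≤ L / 2 then joinRandom {x | layerNo x = ℓ + 1} a else recursiveStep rule ℓ a

end RandomAssignment

/-- The probability of an event under a discrete distribution. -/
noncomputable def prob {α : Type*} (p : PMF α) (E : Set α) : ℝ := (p.toOuterMeasure E).toReal

/-- The step from layer `ℓ` to layer `ℓ + 1` is successful:
`M_{ℓ+1} ≤ (1 - δ) M_ℓ`. -/
def Success {V : Type*} {L t : ℕ} (G : SimpleGraph V) (δ : ℝ) (a : Assignment V L t)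
    (ℓ : ℕ) : Prop :=
  (excess G a (ℓ + 1) : ℝ) ≤ (1 - δ) * (excess G a ℓ : ℝ)

open scoped Classical in
/-- The set of the successful steps `ℓ ∈ [L / 2, L - 1]`. -/
noncomputable def successSet {V : Type*} {L t : ℕ} (G : SimpleGraph V) (δ : ℝ)
    (a : Assignment V L t) : Finset ℕ :=
  {ℓ ∈ Finset.Ico (L / 2) L | Success G δ a ℓ}

open scoped Classical in
/-- The probability that the set of successful trials belongs to `U`, for independent trials
indexed by `I`, each of which succeeds with probability `ρ`. -/
noncomputable def independentTrials (ρ : ℝ) (I : Finset ℕ) (U : Set (Finset ℕ)) : ℝ :=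
  ∑ A ∈ I.powerset with A ∈ U, ρ ^ A.card * (1 - ρ) ^ (I \ A).card

end FastMerger

/-!
Write `M` for the excess before a step. If all classes dominate, every component has, in its class,
about a third of the vertex connectivity many internally disjoint *connectors*: paths to another
component through a single type-1 new node, or through a type-2 and a type-3 new node. They come
from deleting fewer than `k` vertices: what remains is connected, so it has an edge from the
neighborhood of the component to that of the other ones.

A connector is active if its type-1 or type-3 node joins the class of the component, which happens
with probability `1 / t`. Every active connector either forces its component to merge, or its
type-2 node is matched, since otherwise the matching could be enlarged. Hence the merging components
and the matched nodes together meet all active connectors, while few active connectors share a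
component or a type-2 node, so that these sets have expected size at least a constant times `M`.
As there are no more matched nodes than merging components and each merge saves half a component,
the expected decrease of the excess is a constant fraction of `M`. The decrease is at most `M`, so
by the reverse Markov inequality it is a constant fraction of `M` with constant probability. This
holds for every history, whence the comparison with independent trials, by induction on the layers.
-/

namespace FastMerger

open Finset
open scoped BigOperators

section Merging

theorem two_mul_card_add_card_le_of_surjective {K K' : Type*} [Finite K] {f : K → K'}
    (hf : f.Surjective) (Z : Finset K) (hZ : ∀ C ∈ Z, ∃ C' ≠ C, f C' = f C) :
    2 * Nat.card K' + #Z ≤ 2 * Nat.card K := by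
  classical
  have := Fintype.ofFinite K
  have := Finite.of_surjective f hf
  have := Fintype.ofFinite K'
  have hfiber (k' : K') : 2 + #{C ∈ Z | f C = k'} ≤ 2 * #{C | f C = k'} := by
    have hsub : #{C ∈ Z | f C = k'} ≤ #{C | f C = k'} :=
      card_le_card (filter_subset_filter _ (subset_univ _))
    obtain hempty | ⟨C, hC⟩ := ({C ∈ Z | f C = k'} : Finset K).eq_empty_or_nonempty
    · obtain ⟨C, rfl⟩ := hf k'
      have : 0 < #{C' | f C' = f C} := card_pos.2 ⟨C, by simp⟩
      rw [hempty, card_empty]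
      omega
    · obtain ⟨hCZ, rfl⟩ := mem_filter.1 hC
      obtain ⟨C', hne, hC'⟩ := hZ C hCZ
      have : 1 < #{C' | f C' = f C} := one_lt_card.2 ⟨C', by simp [hC'], C, by simp, hne⟩
      omega
  calc
    2 * Nat.card K' + #Z = ∑ k', (2 + #{C ∈ Z | f C = k'}) := by
      rw [sum_add_distrib, ← card_eq_sum_card_fiberwise fun C _ => mem_coe.2 (mem_univ (f C)),
        sum_const, card_univ, smul_eq_mul, Nat.card_eq_fintype_card, mul_comm]
    _ ≤ ∑ k', 2 * #{C | f C = k'} := sum_le_sum fun k' _ => hfiber k'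
    _ = 2 * Nat.card K := by
      rw [← mul_sum, ← card_eq_sum_card_fiberwise fun C _ => mem_coe.2 (mem_univ (f C)),
        card_univ, Nat.card_eq_fintype_card]

variable {W : Type*} {H : SimpleGraph W} {S S' : Set W}

variable (H) in
/-- The component of the larger of two induced subgraphs that contains a given component of the
smaller one. -/
def componentMap (h : S ⊆ S') :
    (H.induce S).ConnectedComponent → (H.induce S').ConnectedComponent :=
  SimpleGraph.ConnectedComponent.map (H.induceHomOfLE h).toHom

variable (H) in
/-- The component `C` of `H[S]` merges with another component when `S` grows to `S'`. -/
def Merges (h : S ⊆ S') (C : (H.induce S).ConnectedComponent) : Prop :=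
  ∃ C' ≠ C, componentMap H h C' = componentMap H h C

theorem componentMap_mk_of_adj (h : S ⊆ S') {u : W} (hu : u ∈ S') (x : S) (hux : H.Adj u x) :
    componentMap H h ((H.induce S).connectedComponentMk x) =
      (H.induce S').connectedComponentMk ⟨u, hu⟩ :=
  SimpleGraph.ConnectedComponent.sound (SimpleGraph.Adj.reachable hux.symm)

theorem componentMap_surjective (h : S ⊆ S') (dom : ∀ x ∈ S', x ∉ S → ∃ y ∈ S, H.Adj x y) :
    (componentMap H h).Surjective := by
  refine SimpleGraph.ConnectedComponent.ind fun ⟨x, hx⟩ => ?_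
  by_cases hxS : x ∈ S
  · exact ⟨(H.induce S).connectedComponentMk ⟨x, hxS⟩, rfl⟩
  · obtain ⟨y, hy, hxy⟩ := dom x hx hxS
    exact ⟨(H.induce S).connectedComponentMk ⟨y, hy⟩, componentMap_mk_of_adj h hx ⟨y, hy⟩ hxy⟩

end Merging

section Connectivity
variable {V : Type*} {G : SimpleGraph V}

theorem exists_adj_of_connected_induce {X P : Set V} (hX : (G.induce X).Connected)
    {p q : V} (hpX : p ∈ X) (hqX : q ∈ X) (hp : p ∈ P) (hq : q ∉ P) :
    ∃ v ∈ X ∩ P, ∃ w ∈ X \ P, G.Adj v w := by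
  obtain ⟨walk⟩ := hX.preconnected ⟨p, hpX⟩ ⟨q, hqX⟩
  obtain ⟨d, -, hv, hw⟩ := walk.exists_boundary_dart {x | (x : V) ∈ P} hp hq
  exact ⟨d.fst, ⟨d.fst.2, hv⟩, d.snd, ⟨d.snd.2, hw⟩, d.adj⟩

variable [Fintype V] [Nonempty V]

theorem vertexConnectivity_mem (G : SimpleGraph V) :
    vertexConnectivity G ∈ {k : ℕ | k < Fintype.card V ∧
      ∀ S : Finset V, #S < k → (G.induce {v | v ∉ S}).Connected} :=
  Nat.sSup_mem ⟨0, Fintype.card_pos, by simp⟩ ⟨Fintype.card V, fun _ hk => hk.1.le⟩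

theorem vertexConnectivity_lt_card (G : SimpleGraph V) :
    vertexConnectivity G < Fintype.card V :=
  (vertexConnectivity_mem G).1

theorem connected_induce_of_card_lt {X : Finset V} (hX : #X < vertexConnectivity G) :
    (G.induce {v | v ∉ X}).Connected :=
  (vertexConnectivity_mem G).2 X hX

theorem exists_mem_closedNeighborhood_notMem (p : V) {X : Finset V}
    (hX : #X < vertexConnectivity G) : ∃ q, (q = p ∨ G.Adj q p) ∧ q ∉ X := by
  classical
  by_contra! hnbhd
  obtain ⟨z, hz⟩ : ∃ z, z ∉ X := by
    by_contra! h
    exact (hX.trans (vertexConnectivity_lt_card G)).ne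
      ((card_eq_iff_eq_univ X).2 (eq_univ_iff_forall.2 h))
  have hpX : p ∈ X := hnbhd p (.inl rfl)
  have hconn : (G.induce {v | v ∉ X.erase p}).Connected :=
    connected_induce_of_card_lt ((card_le_card (erase_subset p X)).trans_lt hX)
  obtain ⟨_, ⟨-, rfl⟩, w, ⟨hw, hwp⟩, hpw⟩ := exists_adj_of_connected_induce hconn
    (P := {p}) (p := p) (q := z) (by simp) (fun h => hz (mem_of_mem_erase h)) rfl
    fun h => hz (h ▸ hpX)
  exact hw (mem_erase.2 ⟨hwp, hnbhd w (.inr hpw.symm)⟩)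

end Connectivity

section Pairings

/-- A partial matching between `α` and `β` all of whose pairs satisfy the relation `r`, given as
the set of its pairs. -/
structure IsPairing {α β : Type*} (r : α → β → Prop) (T : Finset (α × β)) : Prop where
  rel : ∀ e ∈ T, r e.1 e.2
  injOn_fst : Set.InjOn Prod.fst (T : Set (α × β))
  injOn_snd : Set.InjOn Prod.snd (T : Set (α × β))

theorem IsPairing.insert {α β : Type*} [DecidableEq α] [DecidableEq β] {r : α → β → Prop}
    {T : Finset (α × β)} (hT : IsPairing r T) {a : α} {b : β} (hab : r a b)
    (ha : ∀ e ∈ T, e.1 ≠ a) (hb : ∀ e ∈ T, e.2 ≠ b) : IsPairing r (insert (a, b) T) := by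
  have hnot : (a, b) ∉ (T : Set (α × β)) := fun h => ha _ h rfl
  refine ⟨forall_mem_insert _ _ _ |>.2 ⟨hab, hT.rel⟩, ?_, ?_⟩ <;>
    rw [coe_insert, Set.injOn_insert hnot]
  · exact ⟨hT.injOn_fst, fun ⟨e, he, h⟩ => ha e he h⟩
  · exact ⟨hT.injOn_snd, fun ⟨e, he, h⟩ => hb e he h⟩

theorem exists_maximal_isPairing {α β : Type*} [Finite α] [Finite β] (r : α → β → Prop) :
    ∃ T, IsPairing r T ∧ ∀ a b, r a b → ∃ e ∈ T, e.1 = a ∨ e.2 = b := by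
  classical
  have := Fintype.ofFinite α
  have := Fintype.ofFinite β
  obtain ⟨T, hT⟩ := (univ.filter (IsPairing r)).exists_maximal
    ⟨∅, mem_filter.2 ⟨mem_univ _, by simp, by simp, by simp⟩⟩
  have hpair : IsPairing r T := (mem_filter.1 hT.prop).2
  refine ⟨T, hpair, fun a b hab => ?_⟩
  by_contra! h
  have hins := hpair.insert hab (fun e he => (h e he).1) fun e he => (h e he).2
  have hmem := hT.le_of_ge (mem_filter.2 ⟨mem_univ _, hins⟩) (subset_insert _ T)
    (mem_insert_self (a, b) T)
  exact (h _ hmem).1 rfl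

variable {V : Type*} [Fintype V] [Nonempty V] [DecidableEq V] {G : SimpleGraph V}

/-- A maximal pairing works: its endpoints, together with `P ∩ Q`, separate what is left of `P`
from what is left of its complement. -/
theorem exists_isPairing_of_closedNeighborhood_subset {P Q : Finset V} {p q : V}
    (hP : ∀ v, v = p ∨ G.Adj v p → v ∈ P) (hQ : ∀ v, v = q ∨ G.Adj v q → v ∈ Q) :
    ∃ T, IsPairing (fun v w => G.Adj v w ∧ v ∉ Q ∧ w ∉ P) T ∧
      vertexConnectivity G ≤ #(P ∩ Q) + 2 * #T := by
  obtain ⟨T, hT, hmax⟩ := exists_maximal_isPairing fun v w => G.Adj v w ∧ v ∉ Q ∧ w ∉ P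
  refine ⟨T, hT, ?_⟩
  by_contra! hlt
  let X := (P ∩ Q) ∪ (T.image Prod.fst ∪ T.image Prod.snd)
  have hX : #X < vertexConnectivity G := by
    have : #X ≤ _ := card_union_le (P ∩ Q) (T.image Prod.fst ∪ T.image Prod.snd)
    have := card_union_le (T.image Prod.fst) (T.image Prod.snd)
    have := card_image_le (s := T) (f := Prod.fst)
    have := card_image_le (s := T) (f := Prod.snd)
    omega
  have hcap {v : V} (hv : v ∉ X) (hvP : v ∈ P) : v ∉ Q := fun hvQ =>
    hv (mem_union_left _ (mem_inter.2 ⟨hvP, hvQ⟩))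
  obtain ⟨p', hp', hp'X⟩ := exists_mem_closedNeighborhood_notMem p hX
  obtain ⟨q', hq', hq'X⟩ := exists_mem_closedNeighborhood_notMem q hX
  obtain ⟨v, ⟨hvX, hvP⟩, w, ⟨hwX, hwP⟩, hvw⟩ := exists_adj_of_connected_induce
    (connected_induce_of_card_lt hX) (P := P) hp'X hq'X (hP p' hp')
    fun h => hcap hq'X h (hQ q' hq')
  obtain ⟨e, he, rfl | rfl⟩ := hmax v w ⟨hvw, hcap hvX hvP, hwP⟩
  · exact hvX (mem_union_right _ (mem_union_left _ (mem_image_of_mem _ he)))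
  · exact hwX (mem_union_right _ (mem_union_right _ (mem_image_of_mem _ he)))

end Pairings

section Connectors
variable {V K : Type*} {G : SimpleGraph V} {N : K → Set V} {C : K}

/-- A path through new nodes that may connect a component to another one: a short path consists of
a type-1 new node at `u`, a long path of a type-2 new node at `v` and a type-3 new node at `w`. -/
inductive Connector (V : Type*)
  | short (u : V)
  | long (v w : V)

/-- The new node, given by its vertex and its type (counted from `0`), that makes a connector
usable by joining the right class. -/
def Connector.activator : Connector V → V × Fin 3
  | short u => (u, 0)
  | long _ w => (w, 2)

/-- The path `e` leads from the component `C` to another component. Here `N C` is the set of the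
vertices whose new nodes have a neighbor in `C`. The inner node of a long connector must not have
neighbors in other components, so that it belongs to the long connectors of at most one
component. -/
def IsConnector (G : SimpleGraph V) (N : K → Set V) (C : K) : Connector V → Prop
  | .short u => u ∈ N C ∧ ∃ C' ≠ C, u ∈ N C'
  | .long v w => G.Adj v w ∧ v ∈ N C ∧ (∀ C', v ∈ N C' → C' = C) ∧ ∃ C' ≠ C, w ∈ N C'

/-- A set of internally disjoint connectors of the component `C`. -/
structure IsConnectorSystem (G : SimpleGraph V) (N : K → Set V) (C : K)
    (E : Finset (Connector V)) : Prop where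
  isConnector : ∀ e ∈ E, IsConnector G N C e
  injOn_activator : Set.InjOn Connector.activator (E : Set (Connector V))
  eq_of_long : ∀ v w w', .long v w ∈ E → .long v w' ∈ E → w = w'

theorem exists_isConnectorSystem_of_short (T : Finset V)
    (hT : ∀ u ∈ T, IsConnector G N C (.short u)) : ∃ E, IsConnectorSystem G N C E ∧ #E = #T := by
  classical
  refine ⟨T.image .short, ⟨?_, ?_, ?_⟩, card_image_of_injective T fun _ _ => Connector.short.inj⟩
  · simpa only [forall_mem_image] using hT
  · simp only [Set.InjOn, coe_image, Set.forall_mem_image]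
    exact fun u _ u' _ h => congrArg _ (congrArg Prod.fst h)
  · simp

theorem exists_isConnectorSystem_of_isPairing {T : Finset (V × V)}
    (hT : IsPairing (fun v w => IsConnector G N C (.long v w)) T) :
    ∃ E, IsConnectorSystem G N C E ∧ #E = #T := by
  classical
  refine ⟨T.image fun e => .long e.1 e.2, ⟨?_, ?_, ?_⟩, card_image_of_injective T fun e e' h => ?_⟩
  · simpa only [forall_mem_image] using hT.rel
  · simp only [Set.InjOn, coe_image, Set.forall_mem_image]
    exact fun e he e' he' h => by rw [hT.injOn_snd he he' (congrArg Prod.fst h)]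
  · simp only [mem_image, Connector.long.injEq]
    rintro v w w' ⟨e, he, hv, rfl⟩ ⟨e', he', hv', rfl⟩
    rw [hT.injOn_fst he he' (hv.trans hv'.symm)]
  · exact Prod.ext (Connector.long.inj h).1 (Connector.long.inj h).2

theorem exists_isConnectorSystem [Fintype V] [Nonempty V] (hcover : ∀ v, ∃ C, v ∈ N C)
    (hnbhd : ∀ C, ∃ p, ∀ v, v = p ∨ G.Adj v p → v ∈ N C) (hC : ∃ C', C' ≠ C) {s : ℕ}
    (hs : 3 * s ≤ vertexConnectivity G + 2) : ∃ E, IsConnectorSystem G N C E ∧ #E = s := by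
  classical
  obtain ⟨C₁, hC₁⟩ := hC
  obtain ⟨p, hp⟩ := hnbhd C
  obtain ⟨q, hq⟩ := hnbhd C₁
  let P : Finset V := {v | v ∈ N C}
  let Q : Finset V := {v | ∃ C' ≠ C, v ∈ N C'}
  obtain ⟨T, hT, hcard⟩ := exists_isPairing_of_closedNeighborhood_subset (P := P) (Q := Q)
    (fun v hv => mem_filter_univ _ |>.2 (hp v hv))
    fun v hv => mem_filter_univ _ |>.2 ⟨C₁, hC₁, hq v hv⟩
  obtain hshort | hlong : s ≤ #(P ∩ Q) ∨ s ≤ #T := by omega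
  · obtain ⟨T', hT', rfl⟩ := exists_subset_card_eq hshort
    refine exists_isConnectorSystem_of_short T' fun u hu => ?_
    simpa [P, Q, IsConnector] using hT' hu
  · obtain ⟨T', hT', rfl⟩ := exists_subset_card_eq hlong
    refine exists_isConnectorSystem_of_isPairing
      ⟨fun e he => ?_, hT.injOn_fst.mono hT', hT.injOn_snd.mono hT'⟩
    obtain ⟨hadj, hv, hw⟩ := hT.rel e (hT' he)
    simp only [P, Q, mem_filter_univ, not_exists, not_and] at hv hw
    have honly (C') (h : e.1 ∈ N C') : C' = C := not_imp_not.1 (hv C') h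
    obtain ⟨C', hC'⟩ := hcover e.1
    obtain ⟨C'', hC''⟩ := hcover e.2
    exact ⟨hadj, honly C' hC' ▸ hC', honly, C'', fun h => hw (h ▸ hC''), hC''⟩

theorem IsConnector.eq_of_long {C' : K} {v w w' : V} (h : IsConnector G N C (.long v w))
    (h' : IsConnector G N C' (.long v w')) : C = C' :=
  h'.2.2.1 C h.2.1

end Connectors

section ActiveEdges
variable {W ε P κ : Type*} [DecidableEq κ]

/-- The edges of `F` whose activator has received the color of the edge. -/
def activeEdges (act : ε → W) (col : ε → κ) (c : W → κ) (F : Finset ε) : Finset ε :=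
  {e ∈ F | c (act e) = col e}

variable {act : ε → W} {col : ε → κ}

theorem card_activeEdges_le [Fintype P] {E : Finset ε} {D : P → Finset ε} {c : W → κ}
    {Z : Finset P} (hZ : ∀ e ∈ activeEdges act col c E, ∃ p ∈ Z, e ∈ D p) :
    (#(activeEdges act col c E) : ℝ) ≤
      2 * #Z + (∑ p, (#(activeEdges act col c (D p)).offDiag : ℝ)) / 4 := by
  classical
  have hsub : activeEdges act col c E ⊆ Z.biUnion fun p => activeEdges act col c (D p) := by
    intro e he
    obtain ⟨p, hp, hep⟩ := hZ e he
    exact mem_biUnion.2 ⟨p, hp, mem_filter.2 ⟨hep, (mem_filter.1 he).2⟩⟩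
  have hpairs (p : P) : (#(activeEdges act col c (D p)) : ℝ) ≤
      2 + (#(activeEdges act col c (D p)).offDiag : ℝ) / 4 := by
    rw [offDiag_card, Nat.cast_sub (Nat.le_mul_self _), Nat.cast_mul]
    linarith [sq_nonneg (2 * (#(activeEdges act col c (D p)) : ℝ) - 5)]
  calc
    (#(activeEdges act col c E) : ℝ) ≤ ∑ p ∈ Z, (#(activeEdges act col c (D p)) : ℝ) :=
      mod_cast (card_le_card hsub).trans card_biUnion_le
    _ ≤ ∑ p ∈ Z, (2 + (#(activeEdges act col c (D p)).offDiag : ℝ) / 4) :=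
      sum_le_sum fun p _ => hpairs p
    _ = 2 * #Z + (∑ p ∈ Z, (#(activeEdges act col c (D p)).offDiag : ℝ)) / 4 := by
      rw [sum_add_distrib, sum_const, nsmul_eq_mul, sum_div, mul_comm]
    _ ≤ _ := by
      gcongr
      exact subset_univ Z

variable [Fintype W] [DecidableEq W] [Fintype κ] [Nonempty κ]

theorem expect_ite_forall_mem_eq (s : Finset W) (f : W → κ) :
    𝔼 c : W → κ, (if ∀ w ∈ s, c w = f w then (1 : ℝ) else 0) =
      ((Fintype.card κ : ℝ) ^ #s)⁻¹ := by
  have hset : ({c | ∀ w ∈ s, c w = f w} : Finset (W → κ)) =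
      Fintype.piFinset fun w => if w ∈ s then {f w} else univ := by
    ext c
    simp only [mem_filter_univ, Fintype.mem_piFinset]
    refine forall_congr' fun w => ?_
    split_ifs with hw <;> simp [hw]
  have hcard : #{c : W → κ | ∀ w ∈ s, c w = f w} = Fintype.card κ ^ #sᶜ := by
    rw [hset, Fintype.card_piFinset]
    simp [apply_ite card, prod_ite, filter_not, ← compl_eq_univ_sdiff]
  have : (Fintype.card κ : ℝ) ≠ 0 := Nat.cast_ne_zero.2 Fintype.card_ne_zero
  rw [Fintype.expect_eq_sum_div_card, sum_boole, hcard, Fintype.card_fun, ← card_compl_add_card s,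
    pow_add]
  push_cast
  field_simp

theorem expect_card_activeEdges (F : Finset ε) :
    𝔼 c : W → κ, (#(activeEdges act col c F) : ℝ) = #F / Fintype.card κ := by
  have hprob (e : ε) :
      𝔼 c : W → κ, (if c (act e) = col e then (1 : ℝ) else 0) = (Fintype.card κ : ℝ)⁻¹ := by
    simpa using expect_ite_forall_mem_eq {act e} fun _ => col e
  simp only [activeEdges, natCast_card_filter]
  rw [expect_sum_comm, sum_congr rfl fun e _ => hprob e, sum_const, nsmul_eq_mul, div_eq_mul_inv]

theorem expect_card_offDiag_activeEdges_le {F : Finset ε} (hF : #F ≤ Fintype.card κ)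
    (hinj : Set.InjOn (fun e => (act e, col e)) (F : Set ε)) :
    𝔼 c : W → κ, (#(activeEdges act col c F).offDiag : ℝ) ≤ #F / Fintype.card κ := by
  classical
  have hprob : ∀ q ∈ F.offDiag, 𝔼 c : W → κ, (if c (act q.1) = col q.1 ∧ c (act q.2) = col q.2
      then (1 : ℝ) else 0) ≤ ((Fintype.card κ : ℝ) ^ 2)⁻¹ := by
    intro q hq
    obtain ⟨hq₁, hq₂, hne⟩ := mem_offDiag.1 hq
    by_cases hact : act q.1 = act q.2
    · have hcol : col q.1 ≠ col q.2 := fun h => hne (hinj hq₁ hq₂ (Prod.ext hact h))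
      have hnever (c : W → κ) : ¬(c (act q.1) = col q.1 ∧ c (act q.2) = col q.2) :=
        fun h => hcol (h.1.symm.trans ((congrArg c hact).trans h.2))
      simp only [hnever, if_false, expect_const_zero]
      positivity
    · have h := expect_ite_forall_mem_eq {act q.1, act q.2}
        (Function.update (fun _ => col q.2) (act q.1) (col q.1))
      simpa [card_pair hact, Function.update_of_ne (Ne.symm hact)] using h.le
  have hfilter (c : W → κ) : (activeEdges act col c F).offDiag =
      {q ∈ F.offDiag | c (act q.1) = col q.1 ∧ c (act q.2) = col q.2} := by
    ext q
    simp only [activeEdges, mem_offDiag, mem_filter]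
    tauto
  simp only [hfilter, natCast_card_filter]
  rw [expect_sum_comm]
  calc
    _ ≤ (#F.offDiag : ℝ) * ((Fintype.card κ : ℝ) ^ 2)⁻¹ := by
      rw [← nsmul_eq_mul]
      exact sum_le_card_nsmul _ _ _ hprob
    _ ≤ (#F * Fintype.card κ) * ((Fintype.card κ : ℝ) ^ 2)⁻¹ := by
      gcongr
      rw [offDiag_card]
      exact_mod_cast (Nat.sub_le _ _).trans (Nat.mul_le_mul_left _ hF)
    _ = #F / Fintype.card κ := by
      field_simp

/-- The inequality `n ≤ 2 + n (n - 1) / 4` bounds the number of active edges in `D p` by the number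
of pairs of active edges in `D p`, and these pairs are rare because the edges of `D p` become active
pairwise independently (or exclude each other). -/
theorem card_div_le_expect_card_cover [Fintype P] {E : Finset ε} {D : P → Finset ε}
    (hcard : ∀ p, #(D p) ≤ Fintype.card κ)
    (hinj : ∀ p, Set.InjOn (fun e => (act e, col e)) (D p : Set ε))
    (hsum : ∑ p, #(D p) ≤ 2 * #E) {Z : (W → κ) → Finset P}
    (hZ : ∀ c, ∀ e ∈ activeEdges act col c E, ∃ p ∈ Z c, e ∈ D p) :
    (#E / (4 * Fintype.card κ) : ℝ) ≤ 𝔼 c, (#(Z c) : ℝ) := by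
  have : (0 : ℝ) < Fintype.card κ := Nat.cast_pos.2 Fintype.card_pos
  have hactive := expect_le_expect (s := univ) fun c _ => card_activeEdges_le (hZ c)
  have hpairs : ∑ p, 𝔼 c : W → κ, (#(activeEdges act col c (D p)).offDiag : ℝ) ≤
      2 * #E / Fintype.card κ :=
    calc
      _ ≤ ∑ p, (#(D p) / Fintype.card κ : ℝ) :=
        sum_le_sum fun p _ => expect_card_offDiag_activeEdges_le (hcard p) (hinj p)
      _ ≤ _ := by
        rw [← sum_div]
        gcongr
        exact_mod_cast hsum
  rw [expect_card_activeEdges, expect_add_distrib, ← mul_expect, ← expect_div, expect_sum_comm]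
    at hactive
  calc
    (#E / (4 * Fintype.card κ) : ℝ)
      = (#E / Fintype.card κ - 2 * #E / Fintype.card κ / 4) / 2 := by field_simp; ring
    _ ≤ _ := by linarith

end ActiveEdges

section ActiveConnectors
variable {V W ι : Type*} {K : ι → Type*} {G : SimpleGraph V} {N : ∀ i, K i → Set V}
  {node : V × Fin 3 → W} {𝓔 : (Σ i, K i) → Finset (Connector V)}

/-- The component or the vertex of the type-2 new node `p` lies on the connector `e.2` of the
component `e.1`. -/
def LiesOn : (Σ i, K i) ⊕ V → (Σ _ : (Σ i, K i), Connector V) → Prop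
  | .inl C, e => e.1 = C
  | .inr v, e => ∃ w, e.2 = .long v w

/-- The set `Z` of components and of vertices of type-2 new nodes meets every connector whose
activator `node e.activator` joins, in the class assignment `c`, the class of the component. -/
def IsActiveCover (G : SimpleGraph V) (N : ∀ i, K i → Set V) (node : V × Fin 3 → W) (c : W → ι)
    (Z : Finset ((Σ i, K i) ⊕ V)) : Prop :=
  ∀ C e, IsConnector G (N C.1) C.2 e → c (node e.activator) = C.1 → ∃ p ∈ Z, LiesOn p ⟨C, e⟩

theorem LiesOn.fst_eq {v : V} {e e' : Σ _ : (Σ i, K i), Connector V}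
    (he : IsConnector G (N e.1.1) e.1.2 e.2) (he' : IsConnector G (N e'.1.1) e'.1.2 e'.2)
    (hv : LiesOn (.inr v) e) (hv' : LiesOn (.inr v) e') (hclass : e.1.1 = e'.1.1) :
    e.1 = e'.1 := by
  obtain ⟨⟨i, C⟩, e⟩ := e
  obtain ⟨⟨i', C'⟩, e'⟩ := e'
  obtain ⟨w, rfl⟩ := hv
  obtain ⟨w', rfl⟩ := hv'
  obtain rfl : i = i' := hclass
  exact congrArg (Sigma.mk i) (he.eq_of_long he')

theorem injOn_class_of_liesOn_inr
    (h𝓔 : ∀ C, IsConnectorSystem G (N C.1) C.2 (𝓔 C)) (v : V) :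
    Set.InjOn (fun e : Σ _ : (Σ i, K i), Connector V => e.1.1)
      {e | e.2 ∈ 𝓔 e.1 ∧ LiesOn (.inr v) e} := by
  rintro ⟨C, e⟩ ⟨he, hv⟩ ⟨C', e'⟩ ⟨he', hv'⟩ hclass
  obtain rfl : C = C' :=
    LiesOn.fst_eq ((h𝓔 C).isConnector e he) ((h𝓔 C').isConnector e' he') hv hv' hclass
  obtain ⟨w, rfl⟩ := hv
  obtain ⟨w', rfl⟩ := hv'
  rw [(h𝓔 C).eq_of_long v w w' he he']

theorem injOn_activator_of_liesOn_inl (hnode : node.Injective)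
    (h𝓔 : ∀ C, IsConnectorSystem G (N C.1) C.2 (𝓔 C)) (C : Σ i, K i) :
    Set.InjOn (fun e : Σ _ : (Σ i, K i), Connector V => node e.2.activator)
      {e | e.2 ∈ 𝓔 e.1 ∧ LiesOn (.inl C) e} := by
  rintro ⟨_, e⟩ ⟨he, rfl⟩ ⟨_, e'⟩ ⟨he', rfl⟩ h
  exact congrArg (Sigma.mk _) ((h𝓔 _).injOn_activator he he' (hnode h))

variable [Fintype ι] [∀ i, Fintype (K i)]

open scoped Classical in
theorem card_liesOn_le_two [Fintype V] (e : Σ _ : (Σ i, K i), Connector V) :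
    #{p | LiesOn p e} ≤ 2 := by
  have hsub : ∃ p, ({p | LiesOn p e} : Finset ((Σ i, K i) ⊕ V)) ⊆ {.inl e.1, p} := by
    obtain ⟨C, u | ⟨v, w⟩⟩ := e
    · refine ⟨.inl C, fun p hp => ?_⟩
      obtain C' | v := p <;> replace hp := (mem_filter.1 hp).2 <;> simp_all [LiesOn]
    · refine ⟨.inr v, fun p hp => ?_⟩
      obtain C' | v' := p <;> replace hp := (mem_filter.1 hp).2 <;> simp_all [LiesOn]
  obtain ⟨p, hp⟩ := hsub
  exact (card_le_card hp).trans card_le_two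

open scoped Classical in
theorem sum_card_liesOn_le [Fintype V] (E : Finset (Σ _ : (Σ i, K i), Connector V)) :
    ∑ p, #{e ∈ E | LiesOn p e} ≤ 2 * #E :=
  calc
    ∑ p, #{e ∈ E | LiesOn p e} = ∑ e ∈ E, #{p | LiesOn p e} :=
      sum_card_bipartiteAbove_eq_sum_card_bipartiteBelow LiesOn
    _ ≤ #E * 2 := sum_le_card_nsmul _ _ _ fun e _ => card_liesOn_le_two e
    _ = 2 * #E := mul_comm _ _

variable [Fintype W] [DecidableEq W] [Nonempty ι]

theorem sum_card_connectors_div_le_expect_card [Finite V] (hnode : node.Injective)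
    (h𝓔 : ∀ C, IsConnectorSystem G (N C.1) C.2 (𝓔 C)) (hcard : ∀ C, #(𝓔 C) ≤ Fintype.card ι)
    {Z : (W → ι) → Finset ((Σ i, K i) ⊕ V)} (hZ : ∀ c, IsActiveCover G N node c (Z c)) :
    ((∑ C, #(𝓔 C) : ℕ) / (4 * Fintype.card ι) : ℝ) ≤ 𝔼 c, (#(Z c) : ℝ) := by
  classical
  have := Fintype.ofFinite V
  let E : Finset (Σ _ : (Σ i, K i), Connector V) := univ.sigma 𝓔
  let D (p : (Σ i, K i) ⊕ V) : Finset (Σ _ : (Σ i, K i), Connector V) := {e ∈ E | LiesOn p e}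
  have hD (p) : (D p : Set (Σ _ : (Σ i, K i), Connector V)) = {e | e.2 ∈ 𝓔 e.1 ∧ LiesOn p e} := by
    ext; simp [D, E]
  rw [← card_sigma]
  refine card_div_le_expect_card_cover (E := E) (D := D) (act := fun e => node e.2.activator)
    (col := fun e => e.1.1) ?_ ?_ ?_ ?_
  · rintro (C | v)
    · have hC : D (.inl C) = ({C} : Finset _).sigma 𝓔 := by
        ext
        simp only [D, E, mem_filter, mem_sigma, mem_univ, true_and, mem_singleton]
        exact and_comm
      rw [hC, card_sigma, sum_singleton]
      exact hcard C
    · exact card_le_card_of_injOn (t := univ) _ (fun _ _ => mem_univ _)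
        ((injOn_class_of_liesOn_inr h𝓔 v).mono (hD _).le)
  · rintro (C | v) e he e' he' h <;> rw [hD] at he he'
    · exact injOn_activator_of_liesOn_inl hnode h𝓔 C he he' (Prod.mk.inj h).1
    · exact injOn_class_of_liesOn_inr h𝓔 v he he' (Prod.mk.inj h).2
  · exact sum_card_liesOn_le E
  · intro c e he
    obtain ⟨heE, hact⟩ := mem_filter.1 he
    have he𝓔 := (mem_sigma.1 heE).2
    obtain ⟨p, hp, hpe⟩ := hZ c e.1 e.2 ((h𝓔 e.1).isConnector e.2 he𝓔) hact
    exact ⟨p, hp, mem_filter.2 ⟨heE, hpe⟩⟩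

theorem excess_mul_le_expect_card_of_isActiveCover [Fintype V] [Nonempty V]
    (hnode : node.Injective)
    (hcover : ∀ i v, ∃ C, v ∈ N i C) (hnbhd : ∀ i C, ∃ p, ∀ v, v = p ∨ G.Adj v p → v ∈ N i C)
    {s : ℕ} (hs : 3 * s ≤ vertexConnectivity G + 2) (hsι : s ≤ Fintype.card ι)
    {Z : (W → ι) → Finset ((Σ i, K i) ⊕ V)} (hZ : ∀ c, IsActiveCover G N node c (Z c)) :
    (s * (∑ i, ((Fintype.card (K i) : ℝ) - 1)) / (4 * Fintype.card ι) : ℝ) ≤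
      𝔼 c, (#(Z c) : ℝ) := by
  have hsystem (C : Σ i, K i) : ∃ E, IsConnectorSystem G (N C.1) C.2 E ∧
      #E = if 1 < Fintype.card (K C.1) then s else 0 := by
    split_ifs with hC
    · exact exists_isConnectorSystem (hcover _) (hnbhd _)
        (Fintype.exists_ne_of_one_lt_card hC C.2) hs
    · exact ⟨∅, ⟨by simp, by simp, by simp⟩, rfl⟩
  choose 𝓔 h𝓔 hcard using hsystem
  refine le_trans ?_ (sum_card_connectors_div_le_expect_card hnode h𝓔 (fun C => ?_) hZ)
  · rw [Fintype.sum_sigma, mul_sum]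
    push_cast
    gcongr with i
    by_cases hi : 1 < Fintype.card (K i)
    · simp only [hcard, hi, if_true, sum_const, card_univ, nsmul_eq_mul]
      linarith [(Nat.cast_nonneg s : (0 : ℝ) ≤ s)]
    · have : (Fintype.card (K i) : ℝ) ≤ 1 := mod_cast not_lt.1 hi
      simpa [hcard, hi] using mul_nonpos_of_nonneg_of_nonpos (Nat.cast_nonneg s) (sub_nonpos.2 this)
  · rw [hcard]
    split_ifs
    exacts [hsι, Nat.zero_le _]

end ActiveConnectors

section Probability
variable {α β : Type*} {p : PMF α} {f : α → PMF β} {A A' : Set α} {B : Set β}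

theorem toOuterMeasure_ne_top (p : PMF α) (A : Set α) : p.toOuterMeasure A ≠ ⊤ :=
  ne_top_of_le_ne_top ENNReal.one_ne_top <|
    (p.toOuterMeasure.mono (Set.subset_univ A)).trans
      ((p.toOuterMeasure_apply_eq_one_iff _).2 (Set.subset_univ _)).le

theorem prob_nonneg (p : PMF α) (A : Set α) : 0 ≤ prob p A := ENNReal.toReal_nonneg

theorem prob_mono (h : ∀ a ∈ p.support, a ∈ A → a ∈ A') : prob p A ≤ prob p A' :=
  ENNReal.toReal_mono (toOuterMeasure_ne_top p A')
    (PMF.toOuterMeasure_mono p fun a ha => h a ha.2 ha.1)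

theorem prob_congr (h : ∀ a ∈ p.support, a ∈ A ↔ a ∈ A') : prob p A = prob p A' :=
  le_antisymm (prob_mono fun a ha => (h a ha).1) (prob_mono fun a ha => (h a ha).2)

theorem prob_eq_one (h : p.support ⊆ A) : prob p A = 1 := by
  rw [prob, (p.toOuterMeasure_apply_eq_one_iff A).2 h, ENNReal.toReal_one]

theorem prob_eq_zero (h : Disjoint p.support A) : prob p A = 0 := by
  rw [prob, (p.toOuterMeasure_apply_eq_zero_iff A).2 h, ENNReal.toReal_zero]

theorem hasSum_prob_bind (p : PMF α) (f : α → PMF β) (B : Set β) :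
    HasSum (fun a => (p a).toReal * prob (f a) B) (prob (p.bind f) B) := by
  have htop := toOuterMeasure_ne_top (p.bind f) B
  rw [PMF.toOuterMeasure_bind_apply] at htop
  simp only [prob, PMF.toOuterMeasure_bind_apply, ← ENNReal.toReal_mul]
  rw [ENNReal.tsum_toReal_eq (ENNReal.ne_top_of_tsum_ne_top htop)]
  exact ENNReal.hasSum_toReal htop

theorem hasSum_prob (p : PMF α) (A : Set α) :
    HasSum (fun a => (p a).toReal * A.indicator 1 a) (prob p A) := by
  convert hasSum_prob_bind p PMF.pure A using 2 with a
  · congr 1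
    by_cases ha : a ∈ A
    · rw [prob_eq_one (by simpa using ha), Set.indicator_of_mem ha, Pi.one_apply]
    · rw [prob_eq_zero (by simpa using ha), Set.indicator_of_notMem ha]
  · rw [PMF.bind_pure]

theorem prob_bind_eq (h : ∀ a ∈ p.support, ∀ b ∈ (f a).support, b ∈ B ↔ a ∈ A) :
    prob (p.bind f) B = prob p A := by
  refine (hasSum_prob_bind p f B).unique ((hasSum_prob p A).congr_fun fun a => ?_)
  by_cases hsupp : a ∈ p.support
  · by_cases ha : a ∈ A
    · rw [prob_eq_one fun b hb => (h a hsupp b hb).2 ha, Set.indicator_of_mem ha, Pi.one_apply]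
    · rw [prob_eq_zero (Set.disjoint_left.2 fun b hb hB => ha ((h a hsupp b hb).1 hB)),
        Set.indicator_of_notMem ha]
  · simp only [(p.apply_eq_zero_iff a).2 hsupp, ENNReal.toReal_zero, zero_mul]

theorem le_prob_bind_of_subset {ρ : ℝ} (hAA' : A ⊆ A') (hA : ∀ a ∈ A, (f a).support ⊆ B)
    (hA' : ∀ a ∈ p.support, a ∈ A' → ρ ≤ prob (f a) B) :
    (1 - ρ) * prob p A + ρ * prob p A' ≤ prob (p.bind f) B := by
  refine hasSum_le (fun a => ?_) (((hasSum_prob p A).mul_left (1 - ρ)).add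
    ((hasSum_prob p A').mul_left ρ)) (hasSum_prob_bind p f B)
  by_cases hsupp : a ∈ p.support
  · suffices (1 - ρ) * A.indicator 1 a + ρ * A'.indicator 1 a ≤ prob (f a) B by
      calc
        _ = (p a).toReal * ((1 - ρ) * A.indicator 1 a + ρ * A'.indicator 1 a) := by ring
        _ ≤ _ := by gcongr
    by_cases ha : a ∈ A
    · rw [prob_eq_one (hA a ha), Set.indicator_of_mem ha, Set.indicator_of_mem (hAA' ha)]
      simp
    · by_cases ha' : a ∈ A'
      · simpa [ha, ha'] using hA' a hsupp ha'
      · simpa [ha, ha'] using prob_nonneg (f a) B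
  · simp [(p.apply_eq_zero_iff a).2 hsupp]

theorem mul_prob_le_prob_bind {ρ : ℝ} (h : ∀ a ∈ p.support, a ∈ A → ρ ≤ prob (f a) B) :
    ρ * prob p A ≤ prob (p.bind f) B := by
  simpa [prob] using le_prob_bind_of_subset (Set.empty_subset A) (by simp) h

theorem le_prob_bind_of_forall_outcome {r : ℝ}
    (h : ∀ out : α → β, (∀ a, out a ∈ (f a).support) → r ≤ prob p {a | out a ∈ B}) :
    r ≤ prob (p.bind f) B := by
  have hworst (a : α) : ∃ b ∈ (f a).support, b ∈ B → (f a).support ⊆ B := by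
    by_cases hB : (f a).support ⊆ B
    · exact (f a).support_nonempty.imp fun b hb => ⟨hb, fun _ => hB⟩
    · obtain ⟨b, hb, hbB⟩ := Set.not_subset.1 hB
      exact ⟨b, hb, fun h => absurd h hbB⟩
  choose out hout hB using hworst
  calc
    r ≤ 1 * prob p {a | out a ∈ B} := by simpa using h out hout
    _ ≤ prob (p.bind f) B := mul_prob_le_prob_bind fun a _ ha => (prob_eq_one (hB a ha)).ge

end Probability

section ReverseMarkov
variable {Ω : Type*} [Fintype Ω] [Nonempty Ω]

theorem prob_uniformOfFintype (A : Set Ω) :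
    prob (PMF.uniformOfFintype Ω) A = 𝔼 c, A.indicator 1 c := by
  rw [← (hasSum_prob _ A).tsum_eq, tsum_fintype, Fintype.expect_eq_sum_div_card, sum_div]
  refine sum_congr rfl fun c _ => ?_
  rw [PMF.uniformOfFintype_apply, ENNReal.toReal_inv, ENNReal.toReal_natCast, div_eq_inv_mul]

theorem half_le_prob_of_mul_le_expect {f : Ω → ℝ} {X α : ℝ} (hf : ∀ c, 0 ≤ f c)
    (hfX : ∀ c, f c ≤ X) (hα : 0 ≤ α) (hα1 : α ≤ 1) (h : α * X ≤ 𝔼 c, f c) :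
    α / 2 ≤ prob (PMF.uniformOfFintype Ω) {c | α / 2 * X ≤ f c} := by
  obtain ⟨c₀⟩ := ‹Nonempty Ω›
  obtain hX | hX := ((hf c₀).trans (hfX c₀)).eq_or_lt
  · rw [prob_eq_one fun c _ => by simpa [← hX] using hf c]
    linarith
  · set A : Set Ω := {c | α / 2 * X ≤ f c}
    have hpointwise (c : Ω) : f c ≤ X * A.indicator 1 c + α / 2 * X := by
      by_cases hc : c ∈ A
      · rw [Set.indicator_of_mem hc, Pi.one_apply, mul_one]
        exact (hfX c).trans (le_add_of_nonneg_right (by positivity))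
      · rw [Set.indicator_of_notMem hc, mul_zero, zero_add]
        exact (not_le.1 hc).le
    have hexpect : 𝔼 c, f c ≤ X * prob (PMF.uniformOfFintype Ω) A + α / 2 * X := by
      rw [prob_uniformOfFintype, mul_expect]
      calc
        𝔼 c, f c ≤ 𝔼 c, (X * A.indicator 1 c + α / 2 * X) :=
          expect_le_expect fun c _ => hpointwise c
        _ = _ := by rw [expect_add_distrib, Fintype.expect_const]
    refine le_of_mul_le_mul_left ?_ hX
    linarith

end ReverseMarkov

section Trials

theorem independentTrials_empty (ρ : ℝ) (U : Set (Finset ℕ)) [Decidable (∅ ∈ U)] :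
    independentTrials ρ ∅ U = if ∅ ∈ U then 1 else 0 := by
  simp [independentTrials, sum_filter]

theorem independentTrials_insert (ρ : ℝ) {I : Finset ℕ} {n : ℕ} (hn : n ∉ I)
    (U : Set (Finset ℕ)) :
    independentTrials ρ (insert n I) U =
      (1 - ρ) * independentTrials ρ I U + ρ * independentTrials ρ I {A | insert n A ∈ U} := by
  classical
  simp only [independentTrials, sum_filter, sum_powerset_insert hn, mul_sum, mul_ite, mul_zero]
  congr 1 <;> refine sum_congr rfl fun A hA => ?_ <;>
    have hnA : n ∉ A := fun h => hn (mem_powerset.1 hA h)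
  · rw [insert_sdiff_of_notMem _ hnA, card_insert_of_notMem (mt (mem_sdiff.1 · |>.1) hn)]
    congr 1
    ring
  · rw [insert_sdiff_insert, sdiff_insert_of_notMem hn, card_insert_of_notMem hnA]
    congr 1
    ring

variable {α : Type*} {p : ℕ → PMF α} {step : ℕ → α → PMF α} {D : Set α} {σ : ℕ → α → Prop}
  {ρ : ℝ} {m n : ℕ} {a b : α}

open scoped Classical in
/-- The set of the successful trials among those with indices in `[m, n)`, where `σ k a` says that
trial `k` succeeds in the state `a`. -/
noncomputable def successes (σ : ℕ → α → Prop) (m n : ℕ) (a : α) : Finset ℕ :=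
  {k ∈ Ico m n | σ k a}

/-- A Markov chain with laws `p k` and transitions `step k` that carries out trial `k` in the
transition from time `k` to time `k + 1`, for `m ≤ k < n`. The chain remembers the outcomes of the
past trials, and starting from a state of the invariant set `D`, every trial succeeds with
probability at least `ρ`. -/
structure IsTrialChain (p : ℕ → PMF α) (step : ℕ → α → PMF α) (D : Set α) (σ : ℕ → α → Prop)
    (ρ : ℝ) (m n : ℕ) : Prop where
  law_succ : ∀ k ∈ Ico m n, p (k + 1) = (p k).bind (step k)
  mem_of_mem_support : ∀ k ∈ Ico m n, ∀ a ∈ D, (step k a).support ⊆ D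
  success_iff : ∀ k ∈ Ico m n, ∀ a, ∀ b ∈ (step k a).support, ∀ j ∈ Ico m k, σ j b ↔ σ j a
  le_prob_success : ∀ k ∈ Ico m n, ∀ a ∈ D, ρ ≤ prob (step k a) {b | σ k b}

theorem IsTrialChain.mono {n' : ℕ} (h : IsTrialChain p step D σ ρ m n') (hn : n ≤ n') :
    IsTrialChain p step D σ ρ m n :=
  have hsub {k : ℕ} (hk : k ∈ Ico m n) : k ∈ Ico m n' := Ico_subset_Ico_right hn hk
  ⟨fun k hk => h.law_succ k (hsub hk), fun k hk => h.mem_of_mem_support k (hsub hk),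
    fun k hk => h.success_iff k (hsub hk), fun k hk => h.le_prob_success k (hsub hk)⟩

open scoped Classical in
theorem IsTrialChain.successes_succ (h : IsTrialChain p step D σ ρ m (n + 1)) (hmn : m ≤ n)
    (hb : b ∈ (step n a).support) :
    successes σ m (n + 1) b =
      if σ n b then insert n (successes σ m n a) else successes σ m n a := by
  have hpast : successes σ m n b = successes σ m n a :=
    filter_congr (h.success_iff n (mem_Ico.2 ⟨hmn, n.lt_succ_self⟩) a b hb)
  rw [← hpast, successes, ← insert_Ico_right_eq_Ico_add_one hmn, filter_insert]
  rfl

theorem IsTrialChain.le_prob_succ (h : IsTrialChain p step D σ ρ m (n + 1)) (hmn : m ≤ n)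
    {U : Set (Finset ℕ)} (hU : IsUpperSet U) :
    (1 - ρ) * prob (p n) {a | a ∈ D ∧ successes σ m n a ∈ U} +
        ρ * prob (p n) {a | a ∈ D ∧ insert n (successes σ m n a) ∈ U} ≤
      prob (p (n + 1)) {a | a ∈ D ∧ successes σ m (n + 1) a ∈ U} := by
  classical
  have hn : n ∈ Ico m (n + 1) := mem_Ico.2 ⟨hmn, n.lt_succ_self⟩
  have hinsert {A : Finset ℕ} (hA : A ∈ U) : insert n A ∈ U := hU (subset_insert n A) hA
  rw [h.law_succ n hn]
  refine le_prob_bind_of_subset (fun a ha => ⟨ha.1, hinsert ha.2⟩) (fun a ha b hb => ?_)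
    (fun a _ ha => ?_)
  · refine ⟨h.mem_of_mem_support n hn a ha.1 hb, ?_⟩
    rw [h.successes_succ hmn hb]
    split_ifs
    exacts [hinsert ha.2, ha.2]
  · refine (h.le_prob_success n hn a ha.1).trans (prob_mono fun b hb hsucc => ?_)
    refine ⟨h.mem_of_mem_support n hn a ha.1 hb, ?_⟩
    rw [h.successes_succ hmn hb, if_pos (by exact hsucc)]
    exact ha.2

theorem IsTrialChain.independentTrials_mul_prob_le (h : IsTrialChain p step D σ ρ m n)
    (hmn : m ≤ n) (hρ : 0 ≤ ρ) (hρ1 : ρ ≤ 1) {U : Set (Finset ℕ)} (hU : IsUpperSet U) :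
    independentTrials ρ (Ico m n) U * prob (p m) D ≤
      prob (p n) {a | a ∈ D ∧ successes σ m n a ∈ U} := by
  classical
  induction n, hmn using Nat.le_induction generalizing U with
  | base =>
    by_cases hU0 : ∅ ∈ U <;> simp [independentTrials_empty, successes, hU0, prob_nonneg]
  | succ n hmn ih =>
    have hU' : IsUpperSet {A : Finset ℕ | insert n A ∈ U} :=
      fun A B hAB hA => hU (insert_subset_insert n hAB) hA
    have hpast := h.mono n.le_succ
    calc
      _ = (1 - ρ) * (independentTrials ρ (Ico m n) U * prob (p m) D) +
          ρ * (independentTrials ρ (Ico m n) {A | insert n A ∈ U} * prob (p m) D) := by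
        rw [← insert_Ico_right_eq_Ico_add_one hmn, independentTrials_insert ρ (by simp)]
        ring
      _ ≤ (1 - ρ) * prob (p n) {a | a ∈ D ∧ successes σ m n a ∈ U} +
          ρ * prob (p n) {a | a ∈ D ∧ insert n (successes σ m n a) ∈ U} :=
        add_le_add (mul_le_mul_of_nonneg_left (ih hpast hU) (sub_nonneg.2 hρ1))
          (mul_le_mul_of_nonneg_left (ih hpast hU') hρ)
      _ ≤ _ := h.le_prob_succ hmn hU

end Trials

section Layers
variable {V : Type*} {L t ℓ m n : ℕ} {G : SimpleGraph V} {δ ρ : ℝ} {a a' b : Assignment V L t}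

theorem upTo_eq_upTo_iff : upTo a ℓ = upTo a' ℓ ↔ ∀ x, layerNo x ≤ ℓ → a x = a' x := by
  refine ⟨fun h x hx => ?_, fun h => funext fun x => ?_⟩
  · simpa [upTo, hx] using congrFun h x
  · by_cases hx : layerNo x ≤ ℓ
    · simpa [upTo, hx] using h x hx
    · simp [upTo, hx]

theorem upTo_eq_self_iff : upTo a ℓ = a ↔ ∀ x, ℓ < layerNo x → a x = none := by
  refine ⟨fun h x hx => ?_, fun h => funext fun x => ?_⟩
  · rw [← h, upTo, if_neg (not_le.2 hx)]
  · by_cases hx : layerNo x ≤ ℓ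
    · simp [upTo, hx]
    · simp [upTo, hx, h x (not_le.1 hx)]

theorem upTo_upTo (a : Assignment V L t) (h : m ≤ n) : upTo (upTo a n) m = upTo a m :=
  upTo_eq_upTo_iff.2 fun _ hx => if_pos (hx.trans h)

theorem classSet_congr (h : upTo a n = upTo a' n) (hmn : m ≤ n) :
    classSet a m = classSet a' m := by
  funext i
  ext x
  refine and_congr_right fun hx => ?_
  rw [upTo_eq_upTo_iff.1 h x (le_trans hx hmn)]

theorem classSet_mono (a : Assignment V L t) (h : m ≤ n) (i : Fin t) :
    classSet a m i ⊆ classSet a n i := fun _ hx => ⟨hx.1.trans h, hx.2⟩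

theorem excess_congr (h : upTo a n = upTo a' n) (hmn : m ≤ n) : excess G a m = excess G a' m := by
  unfold excess Comp
  rw [classSet_congr h hmn]

theorem halfDominating_congr (h : upTo a n = upTo a' n) (hn : L / 2 ≤ n) :
    HalfDominating G a ↔ HalfDominating G a' := by
  rw [HalfDominating, HalfDominating, classSet_congr h hn]

theorem success_congr (h : upTo a n = upTo a' n) (hℓ : ℓ < n) :
    Success G δ a ℓ ↔ Success G δ a' ℓ := by
  rw [Success, Success, excess_congr h hℓ, excess_congr h hℓ.le]

theorem joinMatched_apply_of_not_isNew (M : (bridgingGraph G a ℓ).Subgraph) {x : VNode V L}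
    (hx : ¬ IsNew ℓ 2 x) : joinMatched M x = a x :=
  dif_neg fun ⟨_, h, _⟩ => hx h

variable [Fintype V] [NeZero t]

theorem apply_eq_of_mem_support_joinRandom {S : Set (VNode V L)}
    (h : a' ∈ (joinRandom S a).support) {x : VNode V L} (hx : x ∉ S) : a' x = a x := by
  rw [joinRandom, PMF.mem_support_map_iff] at h
  obtain ⟨c, -, rfl⟩ := h
  exact if_neg hx

/-- The random transition of the class assignment from layer `ℓ` to layer `ℓ + 1`. -/
noncomputable def layerStep (rule : MatchingRule G L t) (ℓ : ℕ) (a : Assignment V L t) :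
    PMF (Assignment V L t) :=
  if ℓ + 1 ≤ L / 2 then joinRandom {x | layerNo x = ℓ + 1} a else recursiveStep rule ℓ a

variable {rule : MatchingRule G L t}

theorem run_succ (rule : MatchingRule G L t) (ℓ : ℕ) :
    run rule (ℓ + 1) = (run rule ℓ).bind (layerStep rule ℓ) := rfl

theorem layerStep_of_half_le (hℓ : L / 2 ≤ ℓ) : layerStep rule ℓ = recursiveStep rule ℓ :=
  funext fun _ => if_neg (by omega)

theorem apply_eq_of_mem_support_recursiveStep (h : a' ∈ (recursiveStep rule ℓ a).support)
    {x : VNode V L} (hx : layerNo x ≠ ℓ + 1) : a' x = a x := by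
  simp only [recursiveStep, PMF.mem_support_bind_iff] at h
  obtain ⟨a₁, h₁, M, -, h⟩ := h
  calc
    a' x = joinMatched M.1 x := apply_eq_of_mem_support_joinRandom h fun h' => hx h'.1.1
    _ = a₁ x := joinMatched_apply_of_not_isNew _ fun h' => hx h'.1
    _ = a x := apply_eq_of_mem_support_joinRandom h₁ fun h' => hx (h'.elim And.left And.left)

theorem apply_eq_of_mem_support_layerStep (h : a' ∈ (layerStep rule ℓ a).support)
    {x : VNode V L} (hx : layerNo x ≠ ℓ + 1) : a' x = a x := by
  unfold layerStep at h
  split_ifs at h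
  · exact apply_eq_of_mem_support_joinRandom h hx
  · exact apply_eq_of_mem_support_recursiveStep h hx

theorem upTo_eq_of_mem_support_layerStep (h : a' ∈ (layerStep rule ℓ a).support) (hm : m ≤ ℓ) :
    upTo a' m = upTo a m :=
  upTo_eq_upTo_iff.2 fun _ hx => apply_eq_of_mem_support_layerStep h (by omega)

theorem upTo_eq_self_of_mem_support_run (h : a ∈ (run rule n).support) : upTo a n = a := by
  induction n generalizing a with
  | zero =>
    rw [run, PMF.support_pure, Set.mem_singleton_iff] at h
    exact upTo_eq_self_iff.2 fun _ _ => by rw [h]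
  | succ n ih =>
    rw [run_succ, PMF.mem_support_bind_iff] at h
    obtain ⟨b, hb, ha⟩ := h
    refine upTo_eq_self_iff.2 fun x hx => ?_
    rw [apply_eq_of_mem_support_layerStep ha hx.ne']
    exact upTo_eq_self_iff.1 (ih hb) x (by omega)

theorem prob_run_upTo_mem (h : m ≤ n) (E : Set (Assignment V L t)) :
    prob (run rule n) {a | upTo a m ∈ E} = prob (run rule m) E := by
  induction n, h using Nat.le_induction with
  | base =>
    refine prob_congr fun a ha => ?_
    rw [Set.mem_ofPred_eq, upTo_eq_self_of_mem_support_run ha]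
  | succ n hmn ih =>
    rw [← ih, run_succ]
    refine prob_bind_eq fun a _ a' ha' => ?_
    rw [Set.mem_ofPred_eq, upTo_eq_of_mem_support_layerStep ha' hmn, Set.mem_ofPred_eq]

theorem prob_run_halfDominating (hn : L / 2 ≤ n) :
    prob (run rule n) {a | HalfDominating G a} =
      prob (run rule (L / 2)) {a | HalfDominating G a} := by
  rw [← prob_run_upTo_mem hn]
  exact prob_congr fun a _ => (halfDominating_congr (upTo_upTo a le_rfl) le_rfl).symm

theorem mul_prob_history_le (hℓ : ℓ < n)
    (hb : ρ ≤ prob (layerStep rule ℓ b) {a | Success G δ a ℓ}) :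
    ρ * prob (run rule n) {a | upTo a ℓ = b} ≤
      prob (run rule n) {a | upTo a ℓ = b ∧ Success G δ a ℓ} := by
  calc
    _ = ρ * prob (run rule ℓ) {b} := by rw [← prob_run_upTo_mem hℓ.le]; rfl
    _ ≤ prob (run rule (ℓ + 1)) {a | upTo a ℓ = b ∧ Success G δ a ℓ} := by
      rw [run_succ]
      refine mul_prob_le_prob_bind fun a ha hab => ?_
      obtain rfl : a = b := hab
      refine hb.trans (prob_mono fun a' ha' hsucc => ⟨?_, hsucc⟩)
      rw [upTo_eq_of_mem_support_layerStep ha' le_rfl, upTo_eq_self_of_mem_support_run ha]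
    _ = _ := by
      rw [← prob_run_upTo_mem (Nat.succ_le_of_lt hℓ)]
      refine prob_congr fun a _ => ?_
      simp only [Set.mem_ofPred_eq]
      rw [upTo_upTo _ ℓ.le_succ, success_congr (upTo_upTo a le_rfl) ℓ.lt_succ_self]

theorem isTrialChain_run (h : ∀ ℓ ∈ Ico (L / 2) L, ∀ b, HalfDominating G b →
    ρ ≤ prob (layerStep rule ℓ b) {a | Success G δ a ℓ}) :
    IsTrialChain (run rule) (layerStep rule) {a | HalfDominating G a}
      (fun ℓ a => Success G δ a ℓ) ρ (L / 2) L where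
  law_succ _ _ := run_succ rule _
  mem_of_mem_support _ hℓ _ ha _ hb :=
    (halfDominating_congr (upTo_eq_of_mem_support_layerStep hb le_rfl) (mem_Ico.1 hℓ).1).2 ha
  success_iff _ _ _ _ hb _ hj :=
    success_congr (upTo_eq_of_mem_support_layerStep hb le_rfl) (mem_Ico.1 hj).2
  le_prob_success := h

theorem independentTrials_mul_prob_halfDominating_le (hρ : 0 ≤ ρ) (hρ1 : ρ ≤ 1)
    (h : ∀ ℓ ∈ Ico (L / 2) L, ∀ b, HalfDominating G b →
      ρ ≤ prob (layerStep rule ℓ b) {a | Success G δ a ℓ})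
    {U : Set (Finset ℕ)} (hU : IsUpperSet U) :
    independentTrials ρ (Ico (L / 2) L) U * prob (run rule L) {a | HalfDominating G a} ≤
      prob (run rule L) {a | HalfDominating G a ∧ successSet G δ a ∈ U} := by
  rw [prob_run_halfDominating (Nat.div_le_self L 2)]
  exact (isTrialChain_run h).independentTrials_mul_prob_le (Nat.div_le_self L 2) hρ hρ1 hU

end Layers

section Domination
variable {W : Type*} {H : SimpleGraph W} {S S' : Set W}

theorem IsDominating.mono (hS : IsDominating H S) (h : S ⊆ S') : IsDominating H S' := fun x hx =>
  (hS x (Set.notMem_subset h hx)).imp fun _ hy => ⟨h hy.1, hy.2⟩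

theorem IsDominating.nonempty [Nonempty W] (hS : IsDominating H S) : S.Nonempty := by
  obtain ⟨x⟩ := ‹Nonempty W›
  by_cases hx : x ∈ S
  exacts [⟨x, hx⟩, (hS x hx).imp fun _ => And.left]

variable {V : Type*} {L t ℓ : ℕ} {G : SimpleGraph V} {a : Assignment V L t}

theorem HalfDominating.isDominating (h : HalfDominating G a) (hℓ : L / 2 ≤ ℓ) (i : Fin t) :
    IsDominating (virtualGraph G L) (classSet a ℓ i) :=
  (h i).mono (classSet_mono a hℓ i)

end Domination

section Excess
variable {V : Type*} {L t ℓ ℓ' : ℕ} {G : SimpleGraph V} {a a' : Assignment V L t}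

theorem excess_nonneg [Finite V] (h : ∀ i, (classSet a ℓ i).Nonempty) : 0 ≤ excess G a ℓ := by
  refine sum_nonneg fun i _ => ?_
  have : Nonempty (classSet a ℓ i) := (h i).to_subtype
  have : 0 < Nat.card (Comp G a ℓ i) := Nat.card_pos
  omega

theorem excess_eq_card_sub [Finite V] (G : SimpleGraph V) (a : Assignment V L t) (ℓ : ℕ) :
    excess G a ℓ = (Nat.card (Σ i, Comp G a ℓ i) : ℤ) - t := by
  simp [excess, Nat.card_sigma]

theorem two_mul_excess_add_card_le [Finite V]
    (hdom : ∀ i, IsDominating (virtualGraph G L) (classSet a ℓ i))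
    (h : ∀ i, classSet a ℓ i ⊆ classSet a' ℓ' i) (Z : Finset (Σ i, Comp G a ℓ i))
    (hZ : ∀ C ∈ Z, Merges (virtualGraph G L) (h C.1) C.2) :
    2 * excess G a' ℓ' + #Z ≤ 2 * excess G a ℓ := by
  let f : (Σ i, Comp G a ℓ i) → Σ i, Comp G a' ℓ' i := fun C =>
    ⟨C.1, componentMap (virtualGraph G L) (h C.1) C.2⟩
  have hf : Function.Surjective f := by
    rintro ⟨i, C⟩
    obtain ⟨C', rfl⟩ := componentMap_surjective (h i) (fun x _ hx => hdom i x hx) C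
    exact ⟨⟨i, C'⟩, rfl⟩
  have hmerge : ∀ C ∈ Z, ∃ C' ≠ C, f C' = f C := fun ⟨i, C⟩ hC => by
    obtain ⟨C', hne, hC'⟩ := hZ _ hC
    exact ⟨⟨i, C'⟩, by simpa using hne, congrArg (Sigma.mk i) hC'⟩
  have hcard := two_mul_card_add_card_le_of_surjective hf Z hmerge
  rw [excess_eq_card_sub, excess_eq_card_sub]
  omega

theorem HalfDominating.excess_anti [Finite V] (h : HalfDominating G a) (hℓ : L / 2 ≤ ℓ)
    (hℓℓ' : ℓ ≤ ℓ') : excess G a ℓ' ≤ excess G a ℓ := by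
  have := two_mul_excess_add_card_le (h.isDominating hℓ) (classSet_mono a hℓℓ') ∅ (by simp)
  simpa using this

end Excess

section Neighborhoods
variable {V : Type*} {L t ℓ : ℕ} {G : SimpleGraph V} {a : Assignment V L t} {i : Fin t}
  {x : VNode V L} {S S' : Set (VNode V L)}

/-- The vertices of `G` that simulate a node of the component `C` or are adjacent to a vertex that
does. A virtual node of a later layer has a neighbor in `C` if and only if its vertex is one of
them. -/
def componentNbhd (G : SimpleGraph V) (C : ((virtualGraph G L).induce S).ConnectedComponent) :
    Set V :=
  {v | ∃ y : S, ((virtualGraph G L).induce S).connectedComponentMk y = C ∧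
    (v = realNode y.1 ∨ G.Adj v (realNode y.1))}

theorem exists_mem_componentNbhd (hS : IsDominating (virtualGraph G L) S) (x : VNode V L) :
    ∃ C : ((virtualGraph G L).induce S).ConnectedComponent, realNode x ∈ componentNbhd G C := by
  by_cases hx : x ∈ S
  · exact ⟨_, ⟨x, hx⟩, rfl, .inl rfl⟩
  · obtain ⟨y, hy, hxy⟩ := hS x hx
    exact ⟨_, ⟨y, hy⟩, rfl, hxy.2⟩

theorem exists_closedNeighborhood_subset_componentNbhd
    (C : ((virtualGraph G L).induce S).ConnectedComponent) :
    ∃ p, ∀ v, v = p ∨ G.Adj v p → v ∈ componentNbhd G C :=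
  C.exists_rep.imp' (fun y : S => realNode y.1) fun y hy _ hv => ⟨y, hy, hv⟩

theorem hasNbrIn_iff_mem_componentNbhd {C : Comp G a ℓ i} (hx : ℓ < layerNo x) :
    HasNbrIn G a ℓ x C ↔ realNode x ∈ componentNbhd G C := by
  refine exists_congr fun y => and_congr_right fun _ => and_iff_right ?_
  rintro rfl
  exact hx.not_ge y.2.1

theorem HasNbrIn.componentMap_eq {C : Comp G a ℓ i} (hC : HasNbrIn G a ℓ x C)
    (h : classSet a ℓ i ⊆ S') (hx : x ∈ S') :
    componentMap (virtualGraph G L) h C =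
      ((virtualGraph G L).induce S').connectedComponentMk ⟨x, hx⟩ := by
  obtain ⟨y, rfl, hxy⟩ := hC
  exact componentMap_mk_of_adj h hx y hxy

end Neighborhoods

section BridgingMatching
variable {V : Type*} {L t ℓ : ℕ} {G : SimpleGraph V} {a a' : Assignment V L t}
  {M : (bridgingGraph G a ℓ).Subgraph} {C C' : Σ i, Comp G a ℓ i} {x x' : VNode V L}

theorem mem_verts_or_mem_verts_of_adj {W : Type*} {H : SimpleGraph W} (M : MaximalMatching H)
    {p q : W} (h : H.Adj p q) : p ∈ M.1.verts ∨ q ∈ M.1.verts := by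
  by_contra! hfree
  have hedge := SimpleGraph.Subgraph.IsMatching.subgraphOfAdj h
  have hdisj : Disjoint M.1.support (H.subgraphOfAdj h).support := by
    rw [M.2.1.support_eq_verts, hedge.support_eq_verts, SimpleGraph.subgraphOfAdj_verts]
    simpa using hfree
  have hle := M.2.2 (M.2.1.sup hedge hdisj) le_sup_left
  exact hfree.1 (hle.1 (by simp))

theorem bridgingGraph_adj_inl_iff {q : BridgeVertex G a ℓ} :
    (bridgingGraph G a ℓ).Adj (.inl C) q ↔ ∃ v, q = .inr v ∧ Bridges G a ℓ C.2 v.1 := by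
  rw [bridgingGraph, SimpleGraph.fromRel_adj]
  constructor
  · rintro ⟨-, ⟨C', v, h, rfl, hb⟩ | ⟨C', v, -, h, -⟩⟩
    · cases h
      exact ⟨v, rfl, hb⟩
    · cases h
  · rintro ⟨v, rfl, hb⟩
    exact ⟨Sum.inl_ne_inr, .inl ⟨C, v, rfl, rfl, hb⟩⟩

theorem MatchedTo.bridges (h : MatchedTo M C x) : Bridges G a ℓ C.2 x := by
  obtain ⟨hx, h⟩ := h
  obtain ⟨v, hv, hb⟩ := bridgingGraph_adj_inl_iff.1 h.adj_sub
  cases hv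
  exact hb

theorem MatchedTo.left_unique (hM : M.IsMatching) (h : MatchedTo M C x) (h' : MatchedTo M C' x) :
    C = C' :=
  Sum.inl_injective (hM.eq_of_adj_right h.2 h'.2)

theorem MatchedTo.right_unique (hM : M.IsMatching) (h : MatchedTo M C x)
    (h' : MatchedTo M C x') : x = x' :=
  congrArg Subtype.val (Sum.inr_injective (hM.eq_of_adj_left h.2 h'.2))

theorem MatchedTo.joinMatched_apply (hM : M.IsMatching) (h : MatchedTo M C x) :
    joinMatched M x = some C.1 := by
  have hex : ∃ C, MatchedTo M C x := ⟨C, h⟩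
  rw [joinMatched, dif_pos hex, MatchedTo.left_unique hM hex.choose_spec h]

theorem exists_matchedTo_of_bridges (M : MaximalMatching (bridgingGraph G a ℓ))
    (hx : IsNew ℓ 2 x) (h : Bridges G a ℓ C.2 x) :
    (∃ x', MatchedTo M.1 C x') ∨ ∃ C', MatchedTo M.1 C' x := by
  have hadj : (bridgingGraph G a ℓ).Adj (.inl C) (.inr ⟨x, hx⟩) :=
    bridgingGraph_adj_inl_iff.2 ⟨_, rfl, h⟩
  refine (mem_verts_or_mem_verts_of_adj M hadj).imp (fun hC => ?_) fun hx' => ?_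
  · obtain ⟨q, hq, -⟩ := M.2.1 hC
    obtain ⟨x', rfl, -⟩ := bridgingGraph_adj_inl_iff.1 hq.adj_sub
    exact ⟨x'.1, x'.2, hq⟩
  · obtain ⟨C' | x', hq, -⟩ := M.2.1 hx'
    · exact ⟨C', hx, hq.symm⟩
    · simpa [bridgingGraph] using hq.adj_sub

/-- The assignment `a'` arises from `a` when the nodes matched by `M` join the classes of their
components and the other type-2 new nodes join arbitrary classes. -/
structure FollowsMatching (M : (bridgingGraph G a ℓ).Subgraph) (a' : Assignment V L t) : Prop where
  apply_of_not_isNew : ∀ x, ¬ IsNew ℓ 2 x → a' x = a x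
  apply_of_matchedTo : ∀ C x, MatchedTo M C x → a' x = some C.1

theorem followsMatching_of_mem_support_joinRandom [Fintype V] [NeZero t] (hM : M.IsMatching)
    (h : a' ∈ (joinRandom {x | IsNew ℓ 2 x ∧ ¬ ∃ C, MatchedTo M C x} (joinMatched M)).support) :
    FollowsMatching M a' where
  apply_of_not_isNew x hx := by
    rw [apply_eq_of_mem_support_joinRandom h fun h' => hx h'.1,
      joinMatched_apply_of_not_isNew M hx]
  apply_of_matchedTo C x hx := by
    rw [apply_eq_of_mem_support_joinRandom h fun h' => h'.2 ⟨C, hx⟩, hx.joinMatched_apply hM]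

namespace FollowsMatching

theorem upTo_eq (h : FollowsMatching M a') : upTo a' ℓ = upTo a ℓ :=
  upTo_eq_upTo_iff.2 fun x hx => h.apply_of_not_isNew x fun hnew => by
    have := hnew.1
    omega

theorem classSet_subset (h : FollowsMatching M a') (i : Fin t) :
    classSet a ℓ i ⊆ classSet a' (ℓ + 1) i := by
  rw [← classSet_congr h.upTo_eq le_rfl]
  exact classSet_mono a' ℓ.le_succ i

theorem mem_classSet_of_isNew {i : Fin t} {r : ℕ} (h : FollowsMatching M a') (hx : IsNew ℓ r x)
    (hr : r ≠ 2) (hi : a x = some i) : x ∈ classSet a' (ℓ + 1) i :=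
  ⟨hx.1.le, by rw [h.apply_of_not_isNew x fun h2 => hr (hx.2.symm.trans h2.2), hi]⟩

theorem merges_of_isNew_one {i : Fin t} {C : Comp G a ℓ i} (h : FollowsMatching M a')
    (hx : IsNew ℓ 1 x) (hi : a x = some i) (hC : HasNbrIn G a ℓ x C)
    (hC' : ∃ C' ≠ C, HasNbrIn G a ℓ x C') :
    Merges (virtualGraph G L) (h.classSet_subset i) C := by
  obtain ⟨C', hne, hC'⟩ := hC'
  have hmem := h.mem_classSet_of_isNew hx (by decide) hi
  exact ⟨C', hne, (hC'.componentMap_eq _ hmem).trans (hC.componentMap_eq _ hmem).symm⟩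

theorem merges_of_matchedTo (h : FollowsMatching M a') (hx : MatchedTo M C x) :
    Merges (virtualGraph G L) (h.classSet_subset C.1) C.2 := by
  obtain ⟨hxC, -, w, hw, hwi, hadj, C', hne, hwC'⟩ := hx.bridges
  have hxmem : x ∈ classSet a' (ℓ + 1) C.1 := ⟨hx.1.1.le, h.apply_of_matchedTo C x hx⟩
  have hwmem := h.mem_classSet_of_isNew hw (by decide) hwi
  refine ⟨C', hne, ?_⟩
  rw [hxC.componentMap_eq _ hxmem, hwC'.componentMap_eq _ hwmem]
  exact SimpleGraph.ConnectedComponent.sound (SimpleGraph.Adj.reachable hadj.symm)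

end FollowsMatching

end BridgingMatching

section NewNodes
variable {V : Type*} {L ℓ : ℕ}

/-- The virtual node of layer `ℓ + 1` with the given vertex and type (counted from `0`). -/
def newNode (hℓ : ℓ < L) (p : V × Fin 3) : VNode V L := (p.1, ⟨ℓ, hℓ⟩, p.2)

theorem newNode_injective (hℓ : ℓ < L) : Function.Injective (newNode (V := V) hℓ) :=
  fun _ _ h => Prod.ext (Prod.mk.inj h).1 (Prod.mk.inj (Prod.mk.inj h).2).2

theorem isNew_newNode (hℓ : ℓ < L) (v : V) (r : Fin 3) : IsNew ℓ (r + 1) (newNode hℓ (v, r)) :=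
  ⟨rfl, rfl⟩

end NewNodes

section MergingStep
variable {V : Type*} {L t ℓ : ℕ} {G : SimpleGraph V} {a a' : Assignment V L t}
  {M : MaximalMatching (bridgingGraph G a ℓ)} {c : VNode V L → Fin t} {i : Fin t}

theorem hasNbrIn_newNode_iff (hℓ : ℓ < L) {C : Comp G a ℓ i} {v : V} {r : Fin 3} :
    HasNbrIn G a ℓ (newNode hℓ (v, r)) C ↔ v ∈ componentNbhd G C :=
  hasNbrIn_iff_mem_componentNbhd ℓ.lt_succ_self

namespace FollowsMatching

theorem merges_or_matched_of_isConnector (h : FollowsMatching M.1 a') (hℓ : ℓ < L)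
    {C : Comp G a ℓ i} {e : Connector V} (he : IsConnector G (componentNbhd G) C e)
    (hi : a (newNode hℓ e.activator) = some i) :
    Merges (virtualGraph G L) (h.classSet_subset i) C ∨
      ∃ v w, e = .long v w ∧ ∃ C', MatchedTo M.1 C' (newNode hℓ (v, 1)) := by
  cases e with
  | short u =>
    obtain ⟨hu, C', hne, hu'⟩ := he
    exact .inl <| h.merges_of_isNew_one (isNew_newNode hℓ u 0) hi
      ((hasNbrIn_newNode_iff hℓ).2 hu) ⟨C', hne, (hasNbrIn_newNode_iff hℓ).2 hu'⟩
  | long v w =>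
    obtain ⟨hvw, hv, -, C', hne, hw⟩ := he
    by_cases hblock : ∃ u, IsNew ℓ 1 u ∧ a u = some i ∧ HasNbrIn G a ℓ u C ∧
      ∃ C' : Comp G a ℓ i, C' ≠ C ∧ HasNbrIn G a ℓ u C'
    · obtain ⟨u, hu, hui, huC, huC'⟩ := hblock
      exact .inl (h.merges_of_isNew_one hu hui huC huC')
    have hadj : (virtualGraph G L).Adj (newNode hℓ (v, 1)) (newNode hℓ (w, 2)) :=
      ⟨fun h => hvw.ne (Prod.mk.inj h).1, .inr hvw⟩
    have hbridges : Bridges G a ℓ C (newNode hℓ (v, 1)) :=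
      ⟨(hasNbrIn_newNode_iff hℓ).2 hv, hblock, newNode hℓ (w, 2), isNew_newNode hℓ w 2, hi, hadj,
        C', hne, (hasNbrIn_newNode_iff hℓ).2 hw⟩
    obtain ⟨x, hx⟩ | hmatched :=
      exists_matchedTo_of_bridges (C := ⟨i, C⟩) M (isNew_newNode hℓ v 1) hbridges
    · exact .inl (h.merges_of_matchedTo hx)
    · exact .inr ⟨v, w, rfl, hmatched⟩

theorem exists_isActiveCover [Finite V] (h : FollowsMatching M.1 a') (hℓ : ℓ < L)
    (hdom : ∀ i, IsDominating (virtualGraph G L) (classSet a ℓ i))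
    (hc : ∀ x, IsNew ℓ 1 x ∨ IsNew ℓ 3 x → a x = some (c x)) :
    ∃ Z : Finset ((Σ i, Comp G a ℓ i) ⊕ V),
      IsActiveCover G (fun _ C => componentNbhd G C) (newNode hℓ) c Z ∧
        (#Z : ℤ) ≤ 4 * (excess G a ℓ - excess G a' (ℓ + 1)) := by
  classical
  have := Fintype.ofFinite V
  have := Fintype.ofFinite (Σ i, Comp G a ℓ i)
  let merged : Finset (Σ i, Comp G a ℓ i) :=
    {C | Merges (virtualGraph G L) (h.classSet_subset C.1) C.2}
  let matched : Finset V := {v | ∃ C, MatchedTo M.1 C (newNode hℓ (v, 1))}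
  refine ⟨merged.disjSum matched, fun ⟨i, C⟩ e he hact => ?_, ?_⟩
  · have hi : a (newNode hℓ e.activator) = some i := by
      rw [hc, hact]
      cases e
      exacts [.inl (isNew_newNode hℓ _ 0), .inr (isNew_newNode hℓ _ 2)]
    obtain hC | ⟨v, w, rfl, hv⟩ := h.merges_or_matched_of_isConnector hℓ he hi
    · exact ⟨.inl ⟨i, C⟩, inl_mem_disjSum.2 ((mem_filter_univ _).2 hC), rfl⟩
    · exact ⟨.inr v, inr_mem_disjSum.2 ((mem_filter_univ _).2 hv), w, rfl⟩
  · have hle : #matched ≤ #merged := by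
      refine card_le_card_of_forall_subsingleton
        (fun v C => MatchedTo M.1 C (newNode hℓ (v, 1))) (fun v hv => ?_) fun C _ v hv v' hv' => ?_
      · obtain ⟨C, hC⟩ := (mem_filter_univ v).1 hv
        exact ⟨C, (mem_filter_univ C).2 (h.merges_of_matchedTo hC), hC⟩
      · exact congrArg Prod.fst (newNode_injective hℓ (hv.2.right_unique M.2.1 hv'.2))
    have hexcess := two_mul_excess_add_card_le hdom h.classSet_subset merged
      fun C hC => (mem_filter_univ C).1 hC
    rw [card_disjSum]
    omega

end FollowsMatching

end MergingStep

section RecursiveStep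
variable {V : Type*} {L t ℓ : ℕ} {G : SimpleGraph V} {b a' : Assignment V L t}
  {c : VNode V L → Fin t}

open scoped Classical in
/-- The assignment in which the nodes of `S` have joined the classes given by `c`. -/
noncomputable def joinClasses (S : Set (VNode V L)) (b : Assignment V L t) (c : VNode V L → Fin t) :
    Assignment V L t :=
  fun x => if x ∈ S then some (c x) else b x

/-- The assignment in which the new nodes of types 1 and 3 have joined the classes given by `c`. -/
noncomputable def joinOddTypes (ℓ : ℕ) (b : Assignment V L t) (c : VNode V L → Fin t) :
    Assignment V L t :=
  joinClasses {x | IsNew ℓ 1 x ∨ IsNew ℓ 3 x} b c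

theorem upTo_joinOddTypes : upTo (joinOddTypes ℓ b c) ℓ = upTo b ℓ :=
  upTo_eq_upTo_iff.2 fun x hx => if_neg fun h => by
    have := h.elim And.left And.left
    omega

variable [Fintype V] [NeZero t]

/-- The part of the recursive step in which the new nodes of type 2 join their classes. -/
noncomputable def matchStep (rule : MatchingRule G L t) (ℓ : ℕ) (a : Assignment V L t) :
    PMF (Assignment V L t) :=
  (rule ℓ a).bind fun M =>
    joinRandom {x | IsNew ℓ 2 x ∧ ¬ ∃ C, MatchedTo M.1 C x} (joinMatched M.1)

variable {rule : MatchingRule G L t}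

open scoped Classical in
theorem recursiveStep_eq_bind (rule : MatchingRule G L t) (ℓ : ℕ) (b : Assignment V L t) :
    recursiveStep rule ℓ b =
      (PMF.uniformOfFintype (VNode V L → Fin t)).bind fun c =>
        matchStep rule ℓ (joinOddTypes ℓ b c) := by
  rw [recursiveStep, joinRandom, PMF.bind_map]
  rfl

theorem exists_isActiveCover_of_mem_support_matchStep (hℓ : ℓ < L)
    (hdom : ∀ i, IsDominating (virtualGraph G L) (classSet b ℓ i))
    (ha' : a' ∈ (matchStep rule ℓ (joinOddTypes ℓ b c)).support) :
    ∃ Z : Finset ((Σ i, Comp G b ℓ i) ⊕ V),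
      IsActiveCover G (fun _ C => componentNbhd G C) (newNode hℓ) c Z ∧
        (#Z : ℤ) ≤ 4 * (excess G b ℓ - excess G a' (ℓ + 1)) := by
  obtain ⟨M, -, hM⟩ := (PMF.mem_support_bind_iff _ _ _).1 ha'
  have hclass : classSet (joinOddTypes ℓ b c) ℓ = classSet b ℓ :=
    classSet_congr upTo_joinOddTypes le_rfl
  have hcover := (followsMatching_of_mem_support_joinRandom M.2.1 hM).exists_isActiveCover hℓ
    (by rwa [hclass]) fun x hx => if_pos hx
  rw [excess_congr upTo_joinOddTypes le_rfl] at hcover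
  unfold Comp at hcover
  rwa [hclass] at hcover

end RecursiveStep

section StepBound
variable {V : Type*} [Fintype V] {L t ℓ : ℕ} {G : SimpleGraph V} {b : Assignment V L t} {c : ℝ}

/-- If `t ≤ c * vertexConnectivity G`, one step is expected to lower the excess by at least this
fraction. The minimum bounds the ratio of the number `min t ⌈k / 3⌉` of connectors per component
to `t`; a factor `4` is lost in covering the active connectors, and a factor `4` since a covering
set `Z` certifies only a decrease by `#Z / 4`. -/
noncomputable def mergeRate (c : ℝ) : ℝ := min 1 (1 / (3 * c)) / 16

theorem mergeRate_pos (hc : 0 < c) : 0 < mergeRate c :=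
  div_pos (lt_min one_pos (by positivity)) (by norm_num)

theorem mergeRate_le_one (c : ℝ) : mergeRate c ≤ 1 := by
  have := min_le_left 1 (1 / (3 * c))
  unfold mergeRate
  linarith

theorem exists_mergeRate_mul_le (hc : 0 < c) {k : ℕ} (ht : (t : ℝ) ≤ c * k) :
    ∃ s : ℕ, 3 * s ≤ k + 2 ∧ s ≤ t ∧ mergeRate c * (16 * t) ≤ s := by
  refine ⟨min t ((k + 2) / 3), by omega, min_le_left _ _, ?_⟩
  have hk : (k : ℝ) ≤ 3 * ((k + 2) / 3 : ℕ) := by exact_mod_cast (by omega : k ≤ 3 * ((k + 2) / 3))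
  rw [mergeRate, Nat.cast_min, le_min_iff]
  constructor
  · nlinarith [min_le_left 1 (1 / (3 * c)), (Nat.cast_nonneg t : (0 : ℝ) ≤ t)]
  · calc
      min 1 (1 / (3 * c)) / 16 * (16 * t) = min 1 (1 / (3 * c)) * t := by ring
      _ ≤ 1 / (3 * c) * (c * k) := by gcongr; exact min_le_right _ _
      _ = k / 3 := by field_simp
      _ ≤ _ := by linarith

theorem nonempty_of_le_mul_vertexConnectivity [NeZero t]
    (ht : (t : ℝ) ≤ c * vertexConnectivity G) : Nonempty V := by
  by_contra hV
  rw [not_nonempty_iff] at hV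
  have ht0 : (t : ℝ) ≤ 0 := by simpa [vertexConnectivity] using ht
  exact NeZero.ne t (by exact_mod_cast ht0.antisymm (Nat.cast_nonneg t))

variable {rule : MatchingRule G L t} [NeZero t]

theorem mem_support_layerStep_of_mem_support_matchStep (hℓ : L / 2 ≤ ℓ) {a' : Assignment V L t}
    {cl : VNode V L → Fin t} (h : a' ∈ (matchStep rule ℓ (joinOddTypes ℓ b cl)).support) :
    a' ∈ (layerStep rule ℓ b).support := by
  classical
  rw [layerStep_of_half_le hℓ, recursiveStep_eq_bind, PMF.mem_support_bind_iff]
  exact ⟨cl, PMF.mem_support_uniformOfFintype cl, h⟩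

open scoped Classical in
theorem mergeRate_mul_excess_le_expect (hc : 0 < c) (ht : (t : ℝ) ≤ c * vertexConnectivity G)
    (hℓ : ℓ < L) (hdom : ∀ i, IsDominating (virtualGraph G L) (classSet b ℓ i))
    {out : (VNode V L → Fin t) → Assignment V L t}
    (hout : ∀ cl, out cl ∈ (matchStep rule ℓ (joinOddTypes ℓ b cl)).support) :
    mergeRate c * excess G b ℓ ≤
      𝔼 cl, ((excess G b ℓ : ℝ) - (excess G (out cl) (ℓ + 1) : ℝ)) := by
  obtain ⟨v₀⟩ := nonempty_of_le_mul_vertexConnectivity ht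
  have : Nonempty V := ⟨v₀⟩
  have : Nonempty (VNode V L) := ⟨newNode hℓ (v₀, 0)⟩
  have (i : Fin t) : Fintype (Comp G b ℓ i) := Fintype.ofFinite _
  choose Z hZ hcard using fun cl => exists_isActiveCover_of_mem_support_matchStep hℓ hdom (hout cl)
  obtain ⟨s, hsk, hst, hs⟩ := exists_mergeRate_mul_le hc ht
  have hX : (0 : ℝ) ≤ excess G b ℓ := by exact_mod_cast excess_nonneg fun i => (hdom i).nonempty
  have hcover : (s * excess G b ℓ / (4 * t) : ℝ) ≤ 𝔼 cl, (#(Z cl) : ℝ) := by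
    have := excess_mul_le_expect_card_of_isActiveCover (newNode_injective hℓ)
      (fun i v => exists_mem_componentNbhd (hdom i) (newNode hℓ (v, 0)))
      (fun i C => exists_closedNeighborhood_subset_componentNbhd C) hsk
      (by rwa [Fintype.card_fin]) hZ
    simpa [excess, Nat.card_eq_fintype_card] using this
  have ht0 : (0 : ℝ) < t := Nat.cast_pos.2 (NeZero.pos t)
  calc
    mergeRate c * excess G b ℓ = mergeRate c * (16 * t) * excess G b ℓ / (16 * t) := by field_simp
    _ ≤ s * excess G b ℓ / (16 * t) := by gcongr
    _ = s * excess G b ℓ / (4 * t) / 4 := by ring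
    _ ≤ (𝔼 cl, (#(Z cl) : ℝ)) / 4 := by gcongr
    _ = 𝔼 cl, (#(Z cl) : ℝ) / 4 := expect_div _ _ _
    _ ≤ _ := expect_le_expect fun cl _ => ?_
  rw [div_le_iff₀' (by norm_num)]
  exact_mod_cast hcard cl

theorem half_mergeRate_le_prob_layerStep (rule : MatchingRule G L t) (hc : 0 < c)
    (ht : (t : ℝ) ≤ c * vertexConnectivity G) (hℓ : ℓ ∈ Ico (L / 2) L) (hb : HalfDominating G b) :
    mergeRate c / 2 ≤ prob (layerStep rule ℓ b) {a | Success G (mergeRate c / 2) a ℓ} := by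
  classical
  obtain ⟨hℓ₁, hℓ₂⟩ := mem_Ico.1 hℓ
  obtain ⟨v⟩ := nonempty_of_le_mul_vertexConnectivity ht
  have : Nonempty (VNode V L) := ⟨newNode hℓ₂ (v, 0)⟩
  rw [layerStep_of_half_le hℓ₁, recursiveStep_eq_bind]
  refine le_prob_bind_of_forall_outcome fun out hout => ?_
  have hupTo (cl) : upTo (out cl) ℓ = upTo b ℓ :=
    upTo_eq_of_mem_support_layerStep
      (mem_support_layerStep_of_mem_support_matchStep hℓ₁ (hout cl)) le_rfl
  have hdom (cl) : HalfDominating G (out cl) := (halfDominating_congr (hupTo cl) hℓ₁).2 hb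
  have hold (cl) : excess G (out cl) ℓ = excess G b ℓ := excess_congr (hupTo cl) le_rfl
  refine (half_le_prob_of_mul_le_expect (fun cl => ?_) (fun cl => ?_) (mergeRate_pos hc).le
    (mergeRate_le_one c) (mergeRate_mul_excess_le_expect hc ht hℓ₂ (hb.isDominating hℓ₁)
      hout)).trans (prob_mono fun cl _ hcl => ?_)
  · have hanti := hold cl ▸ (hdom cl).excess_anti hℓ₁ ℓ.le_succ
    rw [sub_nonneg]
    exact_mod_cast hanti
  · have hnonneg : 0 ≤ excess G (out cl) (ℓ + 1) :=
      excess_nonneg fun i => ((hdom cl).isDominating (by omega) i).nonempty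
    rw [sub_le_self_iff]
    exact_mod_cast hnonneg
  · rw [Set.mem_ofPred_eq] at hcl
    rw [Set.mem_ofPred_eq, Set.mem_ofPred_eq, Success, hold]
    linarith

end StepBound

end FastMerger

theorem mainTheorem9 (c : ℝ) (hc : 0 < c) :
    ∃ δ ρ : ℝ, 0 < δ ∧ 0 < ρ ∧ ρ ≤ 1 ∧
      ∀ (V : Type*) [Fintype V] (G : SimpleGraph V) (L t : ℕ) [NeZero t]
        (_ht : (t : ℝ) ≤ c * (FastMerger.vertexConnectivity G : ℝ))
        (rule : FastMerger.MatchingRule G L t),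
        -- the excess never increases
        (∀ a ∈ (FastMerger.run rule L).support, FastMerger.HalfDominating G a →
          ∀ ℓ ∈ Finset.Ico (L / 2) L,
            FastMerger.excess G a (ℓ + 1) ≤ FastMerger.excess G a ℓ) ∧
        -- each step succeeds with probability at least `ρ`, given any history `b` of the
        -- layers `1, …, ℓ`
        (∀ ℓ ∈ Finset.Ico (L / 2) L, ∀ b : FastMerger.Assignment V L t,
          FastMerger.HalfDominating G b →
          ρ * FastMerger.prob (FastMerger.run rule L) {a | FastMerger.upTo a ℓ = b} ≤
            FastMerger.prob (FastMerger.run rule L)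
              {a | FastMerger.upTo a ℓ = b ∧ FastMerger.Success G δ a ℓ}) ∧
        -- given domination, the successes of the steps stochastically dominate independent
        -- trials with success probability `ρ`
        (∀ U : Set (Finset ℕ), IsUpperSet U →
          FastMerger.independentTrials ρ (Finset.Ico (L / 2) L) U *
              FastMerger.prob (FastMerger.run rule L) {a | FastMerger.HalfDominating G a} ≤
            FastMerger.prob (FastMerger.run rule L)
              {a | FastMerger.HalfDominating G a ∧ FastMerger.successSet G δ a ∈ U}) := by
  have hrate := FastMerger.mergeRate_pos hc
  have hrate1 := FastMerger.mergeRate_le_one c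
  refine ⟨FastMerger.mergeRate c / 2, FastMerger.mergeRate c / 2, by linarith, by linarith,
    by linarith, fun V _ G L t _ ht rule => ?_⟩
  have hstep : ∀ ℓ ∈ Finset.Ico (L / 2) L, ∀ b, FastMerger.HalfDominating G b → _ :=
    fun ℓ hℓ b hb => FastMerger.half_mergeRate_le_prob_layerStep rule hc ht hℓ hb
  refine ⟨fun a _ ha ℓ hℓ => ?_, fun ℓ hℓ b hb => ?_, fun U hU => ?_⟩
  · exact ha.excess_anti (Finset.mem_Ico.1 hℓ).1 ℓ.le_succ
  · exact FastMerger.mul_prob_history_le (Finset.mem_Ico.1 hℓ).2 (hstep ℓ hℓ b hb)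
  · exact FastMerger.independentTrials_mul_prob_halfDominating_le (by linarith) (by linarith)
      hstep hU
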